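/- **Theorem.** Let $\alpha_{\mathrm{GW}}=\min_{\rho\in[-1,1)}\frac{\arccos(\rho)/\pi}{(1-\rho)/2}\approx 0.87856$ be the Goemans–Williamson constant. There are a randomized algorithm, a polynomial $p$, and absolute positive integer constants $C$ and $K$ (one choice for all $n$, $d$ and all inputs) with the following guarantee. The algorithm is given a finite graph on the vertex set $V=\{1,\dots,n\}$ with nonnegative edge weights $w_{ij}$, together with a feasible $d$-dimensional solution of the Max-Cut SDP with $\ell_2^2$ triangle inequalities, that is, vectors $v_1,\dots,v_n\in\mathbb{R}^d$ with $\|v_i\|_2=1$ for all $i$ and $$\|a_iv_i-a_jv_j\|_2^2+\|a_iv_i-a_kv_k\|_2^2\ \ge\ \|a_jv_j-a_kv_k\|_2^2\qquad\text{for all } i,j,k\in V \text{ and } a_i,a_j,a_k\in\{\pm1\}.$$ It always halts within $p(n+d)$ steps and outputs a cut $x\in\{\pm1\}^V$ such that $$\mathbb{E}\Bigl[\,\sum_{\{i,j\}:\,x_i\ne x_j} w_{ij}\Bigr]\ \ge\ \bigl(\alpha_{\mathrm{GW}}+2^{-Kd}\bigr)\cdot\mathrm{SDP},\qquad \mathrm{SDP}=\frac12\sum_{\{i,j\}}w_{ij}\bigl(1-\langle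 v_i,v_j\rangle\bigr),$$ where both sums run over unordered pairs of vertices ($w_{ij}=0$ for non-edges). Here an algorithm is a program for the real-number RAM: exact arithmetic ($+,-,\times,/$) and comparison of real numbers, rational constants, natural-number indices with addition and truncated subtraction, two-dimensional arrays of reals, unit cost per operation, no rounding of reals to integers, and an instruction that draws an independent standard Gaussian. Moreover, the algorithm is hyperplane rounding followed by local flips of near-boundary vertices: if $g\sim\mathcal{N}(0,I_d)$ is the vector of the first $d$ Gaussian samples, $y_i=\mathrm{sgn}\langle g,v_i\rangle$ (with $\mathrm{sgn}(0)=1$) and $\varepsilon=2^{-Cd}$, then $x_i\ne y_i$ only for vertices $i$ with $|\langle g,v_i\rangle|<\varepsilon$ and $$\sum_{j:\ y_j=y_i,\ |\langle g,v_j\rangle|\ge\varepsilon} w_{ij}\ >\ \sum_{j:\ y_j\ne y_i} w_{ij}.$$ -/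

import Mathlib

open scoped RealInnerProductSpace

namespace MaxCut

noncomputable section

/-! ### Weighted graphs, cuts, and the semidefinite relaxation -/

/-- A finite undirected weighted graph on the vertex set `Fin n`: nonnegative edge weights, no
loops; a pair of weight `0` is a non-edge (or an edge that does not matter). -/
structure WeightedGraph (n : ℕ) where
  /-- the weight of a pair of vertices -/
  weight : Fin n → Fin n → ℝ
  symm : ∀ i j, weight i j = weight j i
  nonneg : ∀ i j, 0 ≤ weight i j
  loopless : ∀ i, weight i i = 0

/-- Total weight of the edges cut by the labelling `x ∈ {±1}^n` (each edge counted once). -/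
def cutWeight {n : ℕ} (G : WeightedGraph n) (x : Fin n → ℤˣ) : ℝ :=
  ∑ i, ∑ j ∈ Finset.Ioi i, if x i ≠ x j then G.weight i j else 0

/-- Objective value `½ ∑_{(i,j) ∈ E} w_{ij} (1 - ⟨v_i, v_j⟩)` of a vector assignment. -/
def sdpValue {n d : ℕ} (G : WeightedGraph n) (v : Fin n → EuclideanSpace ℝ (Fin d)) : ℝ :=
  (1 / 2) * ∑ i, ∑ j ∈ Finset.Ioi i, G.weight i j * (1 - ⟪v i, v j⟫)

/-- Feasibility for the Max-Cut SDP with `ℓ₂²` triangle inequalities. -/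
structure IsFeasible {n d : ℕ} (v : Fin n → EuclideanSpace ℝ (Fin d)) : Prop where
  unit : ∀ i, ‖v i‖ = 1
  triangle : ∀ i j k : Fin n, ∀ a ∈ ({1, -1} : Set ℝ), ∀ b ∈ ({1, -1} : Set ℝ),
    ∀ c ∈ ({1, -1} : Set ℝ),
      ‖b • v j - c • v k‖ ^ 2 ≤ ‖a • v i - b • v j‖ ^ 2 + ‖a • v i - c • v k‖ ^ 2

/-- The Goemans–Williamson constant: the least value of `(arccos ρ / π) / ((1 - ρ) / 2)`. The
endpoint `ρ = 1`, where the quotient is undefined (it tends to infinity there), is left out. -/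
def alphaGW : ℝ :=
  sInf ((fun ρ : ℝ => (Real.arccos ρ / Real.pi) / ((1 - ρ) / 2)) '' Set.Ico (-1) 1)

/-! ### Randomized real-RAM programs

A program has finitely many natural-number registers (used as counters and indices; only addition
and truncated subtraction are available on them) and finitely many two-dimensional arrays of real
numbers, with exact field operations, comparisons, and no rounding operation. Its only source of
randomness is a stream of samples, read one at a time. -/

/-- Contents of the registers and arrays, and the number of samples read so far. -/
@[ext] structure State where
  /-- natural-number registers -/
  reg : ℕ → ℕ
  /-- `mem a i j` is the entry `(i, j)` of the real array number `a` -/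
  mem : ℕ → ℕ → ℕ → ℝ
  /-- number of samples consumed -/
  used : ℕ

/-- Index expressions. -/
inductive NatExpr : Type
  | const (m : ℕ)
  | reg (x : ℕ)
  | add (e f : NatExpr)
  | sub (e f : NatExpr)

/-- Value of an index expression. -/
def NatExpr.eval (s : State) : NatExpr → ℕ
  | .const m => m
  | .reg x => s.reg x
  | .add e f => e.eval s + f.eval s
  | .sub e f => e.eval s - f.eval s

/-- Cost of evaluating an index expression: one unit for each constant, access or operation. -/
def NatExpr.cost : NatExpr → ℕ
  | .const _ => 1
  | .reg _ => 1
  | .add e f => e.cost + f.cost + 1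
  | .sub e f => e.cost + f.cost + 1

/-- Real expressions; the only constants are rational numbers. -/
inductive RealExpr : Type
  | const (q : ℚ)
  | read (a : ℕ) (e f : NatExpr)
  | add (r t : RealExpr)
  | sub (r t : RealExpr)
  | mul (r t : RealExpr)
  | div (r t : RealExpr)

/-- Value of a real expression (a division by zero returns `0`). -/
def RealExpr.eval (s : State) : RealExpr → ℝ
  | .const q => (q : ℝ)
  | .read a e f => s.mem a (e.eval s) (f.eval s)
  | .add r t => r.eval s + t.eval s
  | .sub r t => r.eval s - t.eval s
  | .mul r t => r.eval s * t.eval s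
  | .div r t => r.eval s / t.eval s

/-- Cost of evaluating a real expression: one unit for each constant, access or operation. -/
def RealExpr.cost : RealExpr → ℕ
  | .const _ => 1
  | .read _ e f => e.cost + f.cost + 1
  | .add r t => r.cost + t.cost + 1
  | .sub r t => r.cost + t.cost + 1
  | .mul r t => r.cost + t.cost + 1
  | .div r t => r.cost + t.cost + 1

/-- Tests: strict comparison of two indices or of two real numbers. -/
inductive Test : Type
  | natLT (e f : NatExpr)
  | realLT (r t : RealExpr)

/-- Truth of a test. -/
def Test.Holds (s : State) : Test → Prop
  | .natLT e f => e.eval s < f.eval s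
  | .realLT r t => r.eval s < t.eval s

/-- Cost of a test. -/
def Test.cost : Test → ℕ
  | .natLT e f => e.cost + f.cost + 1
  | .realLT r t => r.cost + t.cost + 1

/-- Programs. -/
inductive Program : Type
  | skip
  | setReg (x : ℕ) (e : NatExpr)
  | setMem (a : ℕ) (e f : NatExpr) (r : RealExpr)
  | sample (a : ℕ) (e f : NatExpr)
  | seq (P Q : Program)
  | ite (b : Test) (P Q : Program)
  | loop (b : Test) (P : Program)

/-- Write the natural number `m` into register `x`. -/
def State.putReg (s : State) (x m : ℕ) : State :=
  { s with reg := fun y => if y = x then m else s.reg y }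

/-- Write the real number `r` into the entry `(i, j)` of array `a`. -/
def State.putMem (s : State) (a i j : ℕ) (r : ℝ) : State :=
  { s with mem := fun a₁ i₁ j₁ => if a₁ = a ∧ i₁ = i ∧ j₁ = j then r else s.mem a₁ i₁ j₁ }

/-- `Exec ω P s t u`: with the sample stream `ω`, the program `P` started in state `s` halts in
state `u`, at total cost `t`. The command `sample` stores the next unread sample; `loop b P` repeats
`P` as long as `b` holds. -/
inductive Exec (ω : ℕ → ℝ) : Program → State → ℕ → State → Prop
  | skip (s : State) : Exec ω .skip s 1 s
  | setReg (s : State) (x : ℕ) (e : NatExpr) :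
      Exec ω (.setReg x e) s (e.cost + 1) (s.putReg x (e.eval s))
  | setMem (s : State) (a : ℕ) (e f : NatExpr) (r : RealExpr) :
      Exec ω (.setMem a e f r) s (e.cost + f.cost + r.cost + 1)
        (s.putMem a (e.eval s) (f.eval s) (r.eval s))
  | sample (s : State) (a : ℕ) (e f : NatExpr) :
      Exec ω (.sample a e f) s (e.cost + f.cost + 1)
        { s.putMem a (e.eval s) (f.eval s) (ω s.used) with used := s.used + 1 }
  | seq {P Q : Program} {s s₁ s₂ : State} {t₁ t₂ : ℕ} (hP : Exec ω P s t₁ s₁)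
      (hQ : Exec ω Q s₁ t₂ s₂) : Exec ω (.seq P Q) s (t₁ + t₂) s₂
  | iteTrue {b : Test} {P Q : Program} {s s₁ : State} {t : ℕ} (hb : b.Holds s)
      (hP : Exec ω P s t s₁) : Exec ω (.ite b P Q) s (b.cost + t) s₁
  | iteFalse {b : Test} {P Q : Program} {s s₁ : State} {t : ℕ} (hb : ¬ b.Holds s)
      (hQ : Exec ω Q s t s₁) : Exec ω (.ite b P Q) s (b.cost + t) s₁
  | loopDone {b : Test} {P : Program} {s : State} (hb : ¬ b.Holds s) :
      Exec ω (.loop b P) s b.cost s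
  | loopStep {b : Test} {P : Program} {s s₁ s₂ : State} {t₁ t₂ : ℕ} (hb : b.Holds s)
      (hP : Exec ω P s t₁ s₁) (hL : Exec ω (.loop b P) s₁ t₂ s₂) :
      Exec ω (.loop b P) s (b.cost + t₁ + t₂) s₂

/-- Once the sample stream is fixed, cost and final state are unique. -/
theorem Exec.unique {ω : ℕ → ℝ} {P : Program} {s s₁ s₂ : State} {t₁ t₂ : ℕ}
    (h₁ : Exec ω P s t₁ s₁) (h₂ : Exec ω P s t₂ s₂) : t₁ = t₂ ∧ s₁ = s₂ := by
  induction h₁ generalizing t₂ s₂ with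
  | skip | setReg | setMem | sample => cases h₂; exact ⟨rfl, rfl⟩
  | seq _ _ ihP ihQ =>
    cases h₂ with
    | seq hP hQ =>
      obtain ⟨rfl, rfl⟩ := ihP hP
      obtain ⟨rfl, rfl⟩ := ihQ hQ
      exact ⟨rfl, rfl⟩
  | iteTrue hb _ ih =>
    cases h₂ with
    | iteTrue _ h => obtain ⟨rfl, rfl⟩ := ih h; exact ⟨rfl, rfl⟩
    | iteFalse hb' _ => exact absurd hb hb'
  | iteFalse hb _ ih =>
    cases h₂ with
    | iteTrue hb' _ => exact absurd hb' hb
    | iteFalse _ h => obtain ⟨rfl, rfl⟩ := ih h; exact ⟨rfl, rfl⟩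
  | loopDone hb =>
    cases h₂ with
    | loopDone _ => exact ⟨rfl, rfl⟩
    | loopStep hb' _ _ => exact absurd hb' hb
  | loopStep hb _ _ ihP ihL =>
    cases h₂ with
    | loopDone hb' => exact absurd hb hb'
    | loopStep _ hP hL =>
      obtain ⟨rfl, rfl⟩ := ihP hP
      obtain ⟨rfl, rfl⟩ := ihL hL
      exact ⟨rfl, rfl⟩

/-- Initial state on the input `(G, v)`: registers `0` and `1` hold the number `n` of vertices and
the dimension `d`, array `0` holds the coordinates of the vectors (row `i` is `v i`), array `1`
holds the matrix of edge weights, and everything else is `0`. -/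
def inputState {n d : ℕ} (G : WeightedGraph n) (v : Fin n → EuclideanSpace ℝ (Fin d)) : State where
  reg x := if x = 0 then n else if x = 1 then d else 0
  mem a i j :=
    if a = 0 then (if h : i < n ∧ j < d then v ⟨i, h.1⟩ ⟨j, h.2⟩ else 0)
    else if a = 1 then (if h : i < n ∧ j < n then G.weight ⟨i, h.1⟩ ⟨j, h.2⟩ else 0)
    else 0
  used := 0

/-- On the input `(G, v)` and the sample stream `ω`, the program `P` halts at cost at most `T`, and
then column `0` of array `2` holds the labels of the cut `x`. -/
def OutputsWithin {n d : ℕ} (P : Program) (G : WeightedGraph n)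
    (v : Fin n → EuclideanSpace ℝ (Fin d)) (ω : ℕ → ℝ) (T : ℕ) (x : Fin n → ℤˣ) : Prop :=
  ∃ (t : ℕ) (s : State), Exec ω P (inputState G v) t s ∧ t ≤ T ∧
    ∀ i : Fin n, s.mem 2 i 0 = (((x i : ℤˣ) : ℤ) : ℝ)

/-- Law of the sample stream: independent standard Gaussians. -/
def gaussianStream : MeasureTheory.Measure (ℕ → ℝ) :=
  MeasureTheory.Measure.infinitePi fun _ : ℕ => ProbabilityTheory.gaussianReal 0 1

/-! ### Hyperplane rounding and local improvement -/

/-- The projection `⟨g, v_i⟩`, where `g` consists of the first `d` samples. -/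
def proj {n d : ℕ} (v : Fin n → EuclideanSpace ℝ (Fin d)) (ω : ℕ → ℝ) (i : Fin n) : ℝ :=
  ⟪WithLp.toLp 2 (fun k : Fin d => ω k), v i⟫

/-- The label `sgn ⟨g, v_i⟩` of hyperplane rounding (ties, of probability zero, go to `1`). -/
def gwLabel {n d : ℕ} (v : Fin n → EuclideanSpace ℝ (Fin d)) (ω : ℕ → ℝ) (i : Fin n) : ℤˣ :=
  if 0 ≤ proj v ω i then 1 else -1

open Classical in
/-- The labelling `x` arises from hyperplane rounding by local flips of near-boundary vertices:
a vertex is relabelled only if it is a candidate (`|⟨g, v_i⟩| < ε`) and its edges to non-candidates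
with its own hyperplane label weigh more than its edges to vertices with the opposite one. -/
def IsLocalFlip {n d : ℕ} (G : WeightedGraph n) (v : Fin n → EuclideanSpace ℝ (Fin d))
    (ε : ℝ) (ω : ℕ → ℝ) (x : Fin n → ℤˣ) : Prop :=
  ∀ i, x i ≠ gwLabel v ω i →
    |proj v ω i| < ε ∧
    (∑ j, if gwLabel v ω j ≠ gwLabel v ω i then G.weight i j else 0) <
      ∑ j, if gwLabel v ω j = gwLabel v ω i ∧ ε ≤ |proj v ω j| then G.weight i j else 0

end

end MaxCut

namespace MaxCut
open MeasureTheory ProbabilityTheory Real Set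

/-! Hyperplane rounding cuts the edge `ij` with probability `arccos ρ / π`, where `ρ = ⟪v i, v j⟫`
(`stdGaussian_sign_ne`), and so already achieves `alphaGW` edge by edge. If `ρ` lies outside the
critical range `(-49/50, -1/3)`, the ratio is at least `9/10` (`ratio_ge_of_not_isCritical`), while
`alphaGW ≤ 88/100`: such edges have slack. An extra gain is needed only on critical edges, and the
local flips supply it.

Fix a vertex `i` and write `v j = ρ • v i + b j` with `b j` orthogonal to `v i`. For a Gaussian `x`,
the number `t = ⟪x, v i⟫` is independent of all `⟪x, b j⟫`. When `|t| < ε`, the sign of `⟪x, v j⟫`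
is that of `⟪x, b j⟫` unless the latter is below `2ε`. Hence, over critical neighbours, stable minus
cross weight is essentially `sgn t * D` with `D = ∑ w_ij sgn ⟪x, b j⟫`. Both signs of `t` occur with
probability of order `ε`, independently of `D`, so the expected surplus is of order `ε * E|D|`
(`integral_surplus_ge`). Simultaneous flips realise at least the sum of the surpluses
(`cutWeight_flipLabel_ge`).

It remains to see that `D` does not nearly vanish. As `D` is bounded by the total weight `W`, we
have `E|D| ≥ E[D²] / W`, and `E[D²]` is `2/π` times the quadratic form of the kernel `arcsin ⟪u j, u
k⟫` in the normalised `b j`. The Taylor coefficients of arcsin are nonnegative and powers of a Gram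
kernel are positive semidefinite, so a single odd power is a lower bound (`sum_arcsin_ge`). Odd
powers alone may cancel, as antipodal pairs show. The triangle inequalities enter here: critical
neighbours satisfy `⟪u j, u k⟫ ≥ -1/2` (`IsCritical.inner_ge`), so a high odd power differs little
from the next even power. An even power is bounded below by Cauchy–Schwarz over the monomials in `d`
variables (`sum_inner_pow_even_ge`); their number is exponential in `d`, which is the source of the
loss `2^{-O(d)}` (`sum_arcsin_inner_ge`).

Finally, an explicit program with nested counting loops computes the flipped labelling in quadratic
time; its correctness follows from loop invariants. -/

theorem measurableSet_sign_ne {α : Type*} [MeasurableSpace α] {f g : α → ℝ} (hf : Measurable f)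
    (hg : Measurable g) : MeasurableSet {a | ¬ (0 ≤ f a ↔ 0 ≤ g a)} :=
  ((measurableSet_le measurable_const hf).iff (measurableSet_le measurable_const hg)).compl

/-! ### Sign disagreement for a Gaussian in the plane -/

section Plane

/-- The integral of the indicator that `cos a` and `cos (a - θ)` have different signs. -/
theorem setIntegral_indicator_cos_sign_ne {θ : ℝ} (h0 : 0 ≤ θ) (hπ : θ ≤ π) :
    ∫ a in Ioo (-π) π, ({a | ¬ (0 ≤ cos a ↔ 0 ≤ cos (a - θ))} : Set ℝ).indicator 1 a
      = (2 * θ : ℝ) := by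
  set D : Set ℝ := {a | ¬ (0 ≤ cos a ↔ 0 ≤ cos (a - θ))} with hD
  have hper : Function.Periodic (D.indicator (1 : ℝ → ℝ)) (2 * π) := by
    intro a
    have : a + 2 * π ∈ D ↔ a ∈ D := by
      have h2 : a + 2 * π - θ = a - θ + 2 * π := by ring
      simp only [hD, mem_ofPred_eq, cos_add_two_pi, h2]
    by_cases ha : a ∈ D
    · rw [indicator_of_mem ha, indicator_of_mem (this.2 ha)]; rfl
    · rw [indicator_of_notMem ha, indicator_of_notMem (fun h => ha (this.1 h))]
  have hpi := pi_pos
  have e1 : ∫ a in Ioo (-π) π, D.indicator (1 : ℝ → ℝ) a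
      = ∫ a in (-π)..(-π + 2 * π), D.indicator (1 : ℝ → ℝ) a := by
    rw [intervalIntegral.integral_of_le (by linarith), integral_Ioc_eq_integral_Ioo]
    congr 2; ring_nf
  -- Shifting the period to start at `-π/2` makes `cos a ≥ 0` a single initial segment, so that `D`
  -- becomes two arcs of length `θ`.
  rw [e1, hper.intervalIntegral_add_eq (-π) (-(π / 2)),
    intervalIntegral.integral_of_le (by linarith), integral_Ioc_eq_integral_Ioo]
  have hDm : MeasurableSet D := measurableSet_sign_ne (by fun_prop) (by fun_prop)
  rw [setIntegral_indicator hDm]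
  have hcos1 : ∀ a, -(π / 2) < a → a < -(π / 2) + 2 * π → (0 ≤ cos a ↔ a ≤ π / 2) := by
    intro a ha1 ha2
    constructor
    · intro h
      by_contra hc
      push Not at hc
      have := cos_neg_of_pi_div_two_lt_of_lt hc (by linarith)
      linarith
    · intro h
      exact cos_nonneg_of_neg_pi_div_two_le_of_le ha1.le h
  have hcos2 : ∀ a, -(π / 2) < a → a < -(π / 2) + 2 * π →
      (0 ≤ cos (a - θ) ↔ θ - π / 2 ≤ a ∧ a ≤ θ + π / 2) := by
    intro a ha1 ha2
    constructor
    · intro h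
      constructor
      · by_contra hc
        push Not at hc
        have := cos_neg_of_pi_div_two_lt_of_lt (x := θ - a) (by linarith) (by linarith)
        rw [← cos_neg, neg_sub] at this
        linarith
      · by_contra hc
        push Not at hc
        have := cos_neg_of_pi_div_two_lt_of_lt (x := a - θ) (by linarith) (by linarith)
        linarith
    · intro h
      exact cos_nonneg_of_neg_pi_div_two_le_of_le (by linarith) (by linarith)
  -- The intersection with `Iio` only matters for `θ = π`, where the second arc reaches the end of
  -- the period.
  have hset : Ioo (-(π / 2)) (-(π / 2) + 2 * π) ∩ D
      = Ioo (-(π / 2)) (θ - π / 2) ∪ (Ioc (π / 2) (θ + π / 2) ∩ Iio (-(π / 2) + 2 * π)) := by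
    ext a
    simp only [mem_inter_iff, mem_union, mem_Ioo, mem_Ioc, mem_Iio, hD, mem_ofPred_eq]
    constructor
    · rintro ⟨⟨h1, h2⟩, h3⟩
      rw [hcos1 a h1 h2, hcos2 a h1 h2] at h3
      by_cases h4 : a ≤ π / 2
      · left
        refine ⟨h1, ?_⟩
        by_contra h5
        push Not at h5
        exact h3 ⟨fun _ => ⟨h5, by linarith⟩, fun _ => h4⟩
      · right
        push Not at h4
        refine ⟨⟨h4, ?_⟩, h2⟩
        by_contra h5
        exact h3 ⟨fun h => absurd h (by linarith), fun h => absurd h.2 h5⟩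
    · rintro (⟨h1, h2⟩ | ⟨⟨h1, h2⟩, h3⟩)
      · refine ⟨⟨h1, by linarith⟩, ?_⟩
        rw [hcos1 a h1 (by linarith), hcos2 a h1 (by linarith)]
        intro h
        have := (h.1 (by linarith)).1
        linarith
      · refine ⟨⟨by linarith, h3⟩, ?_⟩
        rw [hcos1 a (by linarith) h3, hcos2 a (by linarith) h3]
        intro h
        have := h.2 ⟨by linarith, h2⟩
        linarith
  have hae : (Ioc (π / 2) (θ + π / 2) ∩ Iio (-(π / 2) + 2 * π) : Set ℝ)
      =ᵐ[volume] Ioo (π / 2) (θ + π / 2) := by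
    have : (Ioc (π / 2) (θ + π / 2) ∩ Iio (-(π / 2) + 2 * π) : Set ℝ)
      =ᵐ[volume] (Ioo (π / 2) (θ + π / 2) ∩ Iio (-(π / 2) + 2 * π) : Set ℝ) :=
      (Ioo_ae_eq_Ioc.symm).inter (ae_eq_refl _)
    have hs : (Ioo (π / 2) (θ + π / 2) ∩ Iio (-(π / 2) + 2 * π) : Set ℝ)
        = Ioo (π / 2) (θ + π / 2) :=
      inter_eq_left.2 fun a ha => mem_Iio.2 (by linarith [ha.2])
    rwa [hs] at this
  have hdisj : Disjoint (Ioo (-(π / 2)) (θ - π / 2))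
      (Ioc (π / 2) (θ + π / 2) ∩ Iio (-(π / 2) + 2 * π)) := by
    rw [Set.disjoint_left]
    rintro a ⟨_, h1⟩ ⟨⟨h2, _⟩, _⟩
    linarith
  rw [hset]
  simp only [Pi.one_apply, setIntegral_const, smul_eq_mul, mul_one]
  rw [measureReal_union hdisj (measurableSet_Ioc.inter measurableSet_Iio)
    (by simp) (measure_ne_top_of_subset inter_subset_left (by simp)),
    measureReal_congr hae]
  simp only [Real.volume_real_Ioo]
  rw [max_eq_left (by linarith), max_eq_left (by linarith)]
  ring

theorem integral_polar_angular {h : ℝ → ℝ} :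
    ∫ p : ℝ × ℝ in polarCoord.target,
      p.1 • (((√(2 * π))⁻¹ * rexp (-(p.1 * cos p.2) ^ 2 / 2)) *
        ((√(2 * π))⁻¹ * rexp (-(p.1 * sin p.2) ^ 2 / 2)) * h p.2)
      = (∫ r in Ioi (0 : ℝ), r * ((2 * π)⁻¹ * rexp (-r ^ 2 / 2))) * ∫ a in Ioo (-π) π, h a := by
  rw [← setIntegral_prod_mul]
  refine setIntegral_congr_fun (by measurability) fun p _ => ?_
  have h1 : (√(2 * π))⁻¹ * (√(2 * π))⁻¹ = (2 * π)⁻¹ := by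
    rw [← mul_inv, mul_self_sqrt (by positivity)]
  have h2 : rexp (-(p.1 * cos p.2) ^ 2 / 2) * rexp (-(p.1 * sin p.2) ^ 2 / 2)
      = rexp (-p.1 ^ 2 / 2) := by
    rw [← Real.exp_add]
    congr 1
    have := sin_sq_add_cos_sq p.2
    linear_combination (- p.1 ^ 2 / 2) * this
  simp only [smul_eq_mul]
  rw [← h1, ← h2]
  ring

theorem integral_gaussian_prod (F : ℝ × ℝ → ℝ) :
    ∫ p, F p ∂((gaussianReal 0 1).prod (gaussianReal 0 1))
      = ∫ p : ℝ × ℝ, ((√(2 * π))⁻¹ * rexp (-p.1 ^ 2 / 2)) *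
        ((√(2 * π))⁻¹ * rexp (-p.2 ^ 2 / 2)) * F p := by
  rw [gaussianReal_of_var_ne_zero _ one_ne_zero,
    prod_withDensity (measurable_gaussianPDF 0 1) (measurable_gaussianPDF 0 1),
    integral_withDensity_eq_integral_toReal_smul (by fun_prop)]
  · rw [Measure.volume_eq_prod]
    refine integral_congr_ae (ae_of_all _ fun p => ?_)
    simp [ENNReal.toReal_mul, gaussianPDFReal]
  · exact ae_of_all _ fun p => ENNReal.mul_lt_top gaussianPDF_lt_top gaussianPDF_lt_top

theorem integral_gaussian_prod_polar {F : ℝ × ℝ → ℝ} {h : ℝ → ℝ}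
    (hF : ∀ r a, 0 < r → F (r * cos a, r * sin a) = h a) :
    ∫ p, F p ∂((gaussianReal 0 1).prod (gaussianReal 0 1))
      = (∫ r in Ioi (0 : ℝ), r * ((2 * π)⁻¹ * rexp (-r ^ 2 / 2))) * ∫ a in Ioo (-π) π, h a := by
  rw [integral_gaussian_prod, ← integral_comp_polarCoord_symm, ← integral_polar_angular]
  refine setIntegral_congr_fun (by measurability) fun p hp => ?_
  simp only [polarCoord_target, mem_prod, mem_Ioi] at hp
  simp only [polarCoord_symm_apply, hF p.1 p.2 hp.1]

theorem gaussian_prod_sign_ne {θ : ℝ} (h0 : 0 ≤ θ) (hπ : θ ≤ π) :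
    ((gaussianReal 0 1).prod (gaussianReal 0 1)).real
      {p : ℝ × ℝ | ¬ (0 ≤ p.1 ↔ 0 ≤ cos θ * p.1 + sin θ * p.2)} = θ / π := by
  have hm : MeasurableSet {p : ℝ × ℝ | ¬ (0 ≤ p.1 ↔ 0 ≤ cos θ * p.1 + sin θ * p.2)} := measurableSet_sign_ne (by fun_prop) (by fun_prop)
  -- The radial integral need not be computed: the constant function `1` shows that it equals `1 /
  -- (2π)`.
  have hone := integral_gaussian_prod_polar (F := fun _ => 1) (h := fun _ => 1) (fun _ _ _ => rfl)
  have hpi := pi_pos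
  simp only [integral_const, smul_eq_mul, mul_one, probReal_univ, measureReal_restrict_apply_univ,
    Real.volume_real_Ioo, sub_neg_eq_add] at hone
  rw [max_eq_left (by linarith)] at hone
  rw [← integral_indicator_one hm, integral_gaussian_prod_polar
    (h := ({a | ¬ (0 ≤ cos a ↔ 0 ≤ cos (a - θ))} : Set ℝ).indicator 1),
    setIntegral_indicator_cos_sign_ne h0 hπ]
  · generalize (∫ r in Ioi (0 : ℝ), r * ((2 * π)⁻¹ * rexp (-r ^ 2 / 2))) = I at hone ⊢
    field_simp
    linear_combination -θ * hone
  · intro r a hr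
    have : (r * cos a, r * sin a) ∈ {p : ℝ × ℝ | ¬ (0 ≤ p.1 ↔ 0 ≤ cos θ * p.1 + sin θ * p.2)} ↔
        a ∈ ({a | ¬ (0 ≤ cos a ↔ 0 ≤ cos (a - θ))} : Set ℝ) := by
      simp only [mem_ofPred_eq]
      rw [show cos θ * (r * cos a) + sin θ * (r * sin a) = r * cos (a - θ) by rw [cos_sub]; ring,
        mul_nonneg_iff_of_pos_left hr, mul_nonneg_iff_of_pos_left hr]
    by_cases h : a ∈ ({a | ¬ (0 ≤ cos a ↔ 0 ≤ cos (a - θ))} : Set ℝ)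
    · rw [indicator_of_mem h, indicator_of_mem (this.2 h)]; rfl
    · rw [indicator_of_notMem h, indicator_of_notMem (fun h' => h (this.1 h'))]

end Plane

/-! ### Projections of the standard Gaussian: independence, separation, small balls -/

section Gaussian

variable {E : Type*} [NormedAddCommGroup E] [InnerProductSpace ℝ E] [FiniteDimensional ℝ E]
  [MeasurableSpace E] [BorelSpace E]

theorem hasGaussianLaw_stdGaussian_clm {F : Type*} [NormedAddCommGroup F] [NormedSpace ℝ F]
    [MeasurableSpace F] [BorelSpace F] [SecondCountableTopology F] (L : E →L[ℝ] F) :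
    HasGaussianLaw (fun x => L x) (stdGaussian E) :=
  (IsGaussian.hasGaussianLaw_id (μ := stdGaussian E)).map_fun L

theorem covariance_stdGaussian_inner (u v : E) :
    cov[fun x => ⟪x, u⟫, fun x => ⟪x, v⟫; stdGaussian E] = ⟪u, v⟫ := by
  have := covarianceBilin_apply_eq_cov (μ := stdGaussian E) IsGaussian.memLp_two_id u v
  rw [covarianceBilin_stdGaussian, innerSL_apply_apply] at this
  rw [this]
  congr 1 <;> ext x <;> exact real_inner_comm _ _

theorem map_inner_stdGaussian {u : E} (hu : ‖u‖ = 1) :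
    (stdGaussian E).map (fun x => ⟪x, u⟫) = gaussianReal 0 1 := by
  have hL : (fun x : E => ⟪x, u⟫) = fun x => innerSL ℝ u x := by
    ext x; rw [innerSL_apply_apply, real_inner_comm]
  have hg : HasGaussianLaw (fun x : E => ⟪x, u⟫) (stdGaussian E) := by
    rw [hL]; exact hasGaussianLaw_stdGaussian_clm _
  rw [hg.map_eq_gaussianReal]
  congr 1
  · rw [hL]; exact integral_strongDual_stdGaussian _
  · rw [← covariance_self hg.aemeasurable, covariance_stdGaussian_inner, real_inner_self_eq_norm_sq,
      hu]
    simp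

/-- Jointly Gaussian and uncorrelated families are independent. Independence from the whole family
`b` at once, not merely from each member, is what the surplus estimate uses. -/
theorem indepFun_inner_stdGaussian {κ : Type*} [Fintype κ] {a : E} {b : κ → E}
    (h : ∀ j, ⟪a, b j⟫ = 0) :
    IndepFun (fun x => ⟪x, a⟫) (fun x j => ⟪x, b j⟫) (stdGaussian E) := by
  have key := HasGaussianLaw.indepFun_of_covariance_eval (P := stdGaussian E) (ι := Unit) (κ := κ)
    (X := fun _ x => ⟪x, a⟫) (Y := fun j x => ⟪x, b j⟫) ?_ ?_
  · exact key.comp (φ := fun f : Unit → ℝ => f ()) (ψ := id) (measurable_pi_apply ()) measurable_id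
  · have := hasGaussianLaw_stdGaussian_clm (E := E)
      (((ContinuousLinearMap.pi fun _ : Unit => innerSL ℝ a).prod
        (ContinuousLinearMap.pi fun j => innerSL ℝ (b j))))
    refine this.congr (ae_of_all _ fun x => ?_)
    ext <;> simp [innerSL_apply_apply, real_inner_comm]
  · intro _ j
    rw [covariance_stdGaussian_inner, h]

theorem map_inner_prod_stdGaussian {e f : E} (he : ‖e‖ = 1) (hf : ‖f‖ = 1) (h : ⟪e, f⟫ = 0) :
    (stdGaussian E).map (fun x => (⟪x, e⟫, ⟪x, f⟫))
      = (gaussianReal 0 1).prod (gaussianReal 0 1) := by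
  have hi : IndepFun (fun x => ⟪x, e⟫) (fun x => ⟪x, f⟫) (stdGaussian E) :=
    (indepFun_inner_stdGaussian (κ := Unit) (a := e) (b := fun _ => f) (fun _ => h)).comp
      (φ := id) (ψ := fun g : Unit → ℝ => g ()) measurable_id (measurable_pi_apply ())
  rw [(indepFun_iff_map_prod_eq_prod_map_map (by fun_prop) (by fun_prop)).1 hi,
    map_inner_stdGaussian he, map_inner_stdGaussian hf]

theorem stdGaussian_inner_eq_zero {u : E} (hu : ‖u‖ = 1) :
    (stdGaussian E).real {x | ⟪x, u⟫ = 0} = 0 := by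
  have : {x : E | ⟪x, u⟫ = 0} = (fun x => ⟪x, u⟫) ⁻¹' {0} := rfl
  rw [this, ← map_measureReal_apply (by fun_prop) (measurableSet_singleton 0),
    map_inner_stdGaussian hu]
  have : NullSingletonClass (gaussianReal 0 1) := nullSingletonClass_gaussianReal one_ne_zero
  rw [measureReal_def, measure_singleton, ENNReal.toReal_zero]

/-- The probability that a random hyperplane separates two unit vectors. -/
theorem stdGaussian_sign_ne {u v : E} (hu : ‖u‖ = 1) (hv : ‖v‖ = 1) :
    (stdGaussian E).real {x | ¬ (0 ≤ ⟪x, u⟫ ↔ 0 ≤ ⟪x, v⟫)} = arccos ⟪u, v⟫ / π := by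
  -- Parallel and antiparallel vectors are split off because the Gram–Schmidt vector `w` below
  -- divides by `sin θ`.
  by_cases h1 : ⟪u, v⟫ = (1 : ℝ)
  · rw [inner_eq_one_iff_of_norm_eq_one hu hv] at h1
    subst h1
    simp [hu]
  by_cases h2 : ⟪u, v⟫ = (-1 : ℝ)
  · rw [inner_eq_neg_one_iff_of_norm_eq_one hu hv] at h2
    have hz := stdGaussian_inner_eq_zero hv
    subst h2
    have : {x : E | ¬ (0 ≤ ⟪x, -v⟫ ↔ 0 ≤ ⟪x, v⟫)} = {x | ⟪x, v⟫ = 0}ᶜ := by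
      ext x
      simp only [inner_neg_right, mem_ofPred_eq, mem_compl_iff]
      grind
    rw [this, measureReal_compl (measurableSet_eq_fun (by fun_prop) (by fun_prop)), hz]
    simp [inner_neg_left, hv, pi_ne_zero]
  have hle := abs_real_inner_le_norm u v
  rw [hu, hv, one_mul, abs_le] at hle
  set θ := arccos ⟪u, v⟫ with hθ
  have hcos : cos θ = ⟪u, v⟫ := cos_arccos hle.1 hle.2
  have hsin : 0 < sin θ := by
    apply sin_pos_of_pos_of_lt_pi
    · exact arccos_pos.2 (lt_of_le_of_ne hle.2 h1)
    · refine lt_of_le_of_ne (arccos_le_pi _) fun h => ?_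
      exact h2 (by rw [← hcos, ← hθ] at *; rw [h, cos_pi])
  have hv2 : ⟪v, v⟫ = (1 : ℝ) := by rw [real_inner_self_eq_norm_sq, hv]; norm_num
  have hu2 : ⟪u, u⟫ = (1 : ℝ) := by rw [real_inner_self_eq_norm_sq, hu]; norm_num
  set w : E := (sin θ)⁻¹ • (v - cos θ • u) with hw
  have huw : ⟪u, w⟫ = (0 : ℝ) := by
    rw [hw, inner_smul_right, inner_sub_right, inner_smul_right, hu2, hcos]; ring
  have hwn : ‖w‖ = 1 := by
    have : ⟪w, w⟫ = (1 : ℝ) := by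
      rw [hw]
      simp only [inner_smul_left, inner_smul_right, inner_sub_left, inner_sub_right, hu2, hv2,
        RCLike.conj_to_real]
      rw [real_inner_comm u v, ← hcos]
      have := sin_sq_add_cos_sq θ
      field_simp
      linear_combination -this
    rw [real_inner_self_eq_norm_sq] at this
    nlinarith [norm_nonneg w]
  have hvw : v = cos θ • u + sin θ • w := by
    rw [hw, smul_smul, mul_inv_cancel₀ hsin.ne', one_smul]; abel
  have hm : MeasurableSet {p : ℝ × ℝ | ¬ (0 ≤ p.1 ↔ 0 ≤ cos θ * p.1 + sin θ * p.2)} := measurableSet_sign_ne (by fun_prop) (by fun_prop)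
  have := gaussian_prod_sign_ne (arccos_nonneg ⟪u, v⟫) (arccos_le_pi ⟪u, v⟫)
  rw [← hθ, ← map_inner_prod_stdGaussian hu hwn huw, map_measureReal_apply (by fun_prop) hm] at this
  rw [← this]
  congr 1
  ext x
  simp only [mem_ofPred_eq, mem_preimage]
  have : ⟪x, v⟫ = cos θ * ⟪x, u⟫ + sin θ * ⟪x, w⟫ := by
    rw [hvw, inner_add_right, inner_smul_right, inner_smul_right]
  rw [this]

/-- The density is at most `1/2`, since `√(2π) ≥ 2`, and the interval has length `2δ`. -/
theorem stdGaussian_inner_mem_le {u : E} (hu : ‖u‖ = 1) {δ : ℝ} (hδ : 0 ≤ δ) :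
    (stdGaussian E).real {x | |⟪x, u⟫| < δ} ≤ δ := by
  have : {x : E | |⟪x, u⟫| < δ} = (fun x => ⟪x, u⟫) ⁻¹' Ioo (-δ) δ := by
    ext x; simp [abs_lt]
  rw [this, ← map_measureReal_apply (by fun_prop) measurableSet_Ioo, map_inner_stdGaussian hu,
    measureReal_def, gaussianReal_apply_eq_integral _ one_ne_zero, ENNReal.toReal_ofReal
      (integral_nonneg fun x => gaussianPDFReal_nonneg _ _ _)]
  calc ∫ x in Ioo (-δ) δ, gaussianPDFReal 0 1 x
      ≤ ∫ x in Ioo (-δ) δ, (1 / 2 : ℝ) := by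
        refine setIntegral_mono ((integrable_gaussianPDFReal 0 1).integrableOn)
          (integrableOn_const (by simp)) fun x => ?_
        simp only [gaussianPDFReal, NNReal.coe_one, mul_one, sub_zero]
        have h1 : rexp (-x ^ 2 / 2) ≤ 1 := exp_le_one_iff.2 (by nlinarith [sq_nonneg x])
        have h2 : (2 : ℝ) ≤ √(2 * π) := le_sqrt_of_sq_le (by nlinarith [pi_gt_three])
        have h3 : (√(2 * π))⁻¹ ≤ 1 / 2 := by
          rw [one_div]; exact inv_anti₀ (by norm_num) h2
        calc _ ≤ (1 / 2 : ℝ) * 1 := mul_le_mul h3 h1 (exp_pos _).le (by norm_num)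
          _ = _ := by norm_num
    _ = δ := by
        simp only [setIntegral_const, Real.volume_real_Ioo, smul_eq_mul]
        rw [max_eq_left (by linarith)]
        ring

theorem gaussianPDFReal_ge {x : ℝ} (hx : |x| ≤ 1) : 1 / 10 ≤ gaussianPDFReal 0 1 x := by
  simp only [gaussianPDFReal, NNReal.coe_one, mul_one, sub_zero]
  have hx2 : x ^ 2 ≤ 1 := by rw [← sq_abs]; nlinarith [abs_nonneg x]
  have h1 : (1 / 2 : ℝ) ≤ rexp (-x ^ 2 / 2) := by
    have := add_one_le_exp (-x ^ 2 / 2)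
    linarith
  have h2 : √(2 * π) ≤ 5 := by
    rw [sqrt_le_left (by norm_num)]
    nlinarith [pi_lt_four]
  have h3 : (1 / 5 : ℝ) ≤ (√(2 * π))⁻¹ := by
    rw [one_div]; exact inv_anti₀ (by positivity) h2
  calc (1 / 10 : ℝ) = 1 / 5 * (1 / 2) := by norm_num
    _ ≤ _ := mul_le_mul h3 h1 (by norm_num) (by positivity)

theorem gaussianReal_Ioo_ge {a b : ℝ} (ha : -1 ≤ a) (hb : b ≤ 1) (hab : a ≤ b) :
    (b - a) / 10 ≤ (gaussianReal 0 1).real (Ioo a b) := by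
  rw [measureReal_def, gaussianReal_apply_eq_integral _ one_ne_zero, ENNReal.toReal_ofReal
      (integral_nonneg fun x => gaussianPDFReal_nonneg _ _ _)]
  calc (b - a) / 10 = ∫ x in Ioo a b, (1 / 10 : ℝ) := by
        simp only [setIntegral_const, Real.volume_real_Ioo, smul_eq_mul]
        rw [max_eq_left (by linarith)]
        ring
    _ ≤ _ := setIntegral_mono_on (integrableOn_const (by simp))
        ((integrable_gaussianPDFReal 0 1).integrableOn) measurableSet_Ioo fun x hx =>
        gaussianPDFReal_ge (abs_le.2 ⟨by linarith [hx.1], by linarith [hx.2]⟩)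

theorem stdGaussian_inner_Ico_ge {u : E} (hu : ‖u‖ = 1) {ε : ℝ} (h0 : 0 ≤ ε) (h1 : ε ≤ 1) :
    ε / 10 ≤ (stdGaussian E).real {x | 0 ≤ ⟪x, u⟫ ∧ ⟪x, u⟫ < ε} := by
  have h : (fun x : E => ⟪x, u⟫) ⁻¹' Ioo 0 ε ⊆ {x | 0 ≤ ⟪x, u⟫ ∧ ⟪x, u⟫ < ε} :=
    fun x hx => ⟨hx.1.le, hx.2⟩
  refine le_trans ?_ (measureReal_mono h)
  rw [← map_measureReal_apply (by fun_prop) measurableSet_Ioo, map_inner_stdGaussian hu]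
  simpa using gaussianReal_Ioo_ge (a := 0) (b := ε) (by norm_num) h1 h0

theorem stdGaussian_inner_Ioo_ge {u : E} (hu : ‖u‖ = 1) {ε : ℝ} (h0 : 0 ≤ ε) (h1 : ε ≤ 1) :
    ε / 10 ≤ (stdGaussian E).real {x | -ε < ⟪x, u⟫ ∧ ⟪x, u⟫ < 0} := by
  have h : {x : E | -ε < ⟪x, u⟫ ∧ ⟪x, u⟫ < 0} = (fun x : E => ⟪x, u⟫) ⁻¹' Ioo (-ε) 0 := rfl
  rw [h, ← map_measureReal_apply (by fun_prop) measurableSet_Ioo, map_inner_stdGaussian hu]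
  simpa using gaussianReal_Ioo_ge (a := -ε) (b := 0) (by linarith) (by norm_num) (by linarith)

end Gaussian
end MaxCut

namespace MaxCut
open MeasureTheory ProbabilityTheory Real Set

/-! ### Nonnegative Taylor coefficients of arcsin -/

section ArcsinKernel

/-- These are the coefficients of `(1 - y)^(-1/2)`. In the rising factorial `(1/2)(3/2)⋯`, each
factor `k + 1/2` is at least `(k + 1)/2`. -/
theorem multichoose_half_ge (n : ℕ) : (1 / 2 : ℝ) ^ n ≤ Ring.multichoose (1 / 2 : ℝ) n := by
  have h : (n.factorial : ℝ) * (1 / 2) ^ n ≤ (ascPochhammer ℝ n).eval (1 / 2 : ℝ) := by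
    induction n with
    | zero => simp
    | succ n ih =>
      rw [ascPochhammer_succ_eval, Nat.factorial_succ, pow_succ]
      push_cast
      calc ((n : ℝ) + 1) * n.factorial * ((1 / 2) ^ n * (1 / 2))
          = (n.factorial * (1 / 2) ^ n) * ((n + 1) / 2) := by ring
        _ ≤ _ := by
          apply mul_le_mul ih (by linarith [(Nat.cast_nonneg n : (0 : ℝ) ≤ n)]) (by positivity)
          exact le_trans (by positivity) ih
  have h2 := Ring.factorial_nsmul_multichoose_eq_ascPochhammer (1 / 2 : ℝ) n
  rw [Polynomial.ascPochhammer_smeval_eq_eval, nsmul_eq_mul] at h2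
  rw [← h2] at h
  exact le_of_mul_le_mul_left h (by positivity)

theorem hasSum_one_div_sqrt_one_sub {y : ℝ} (hy : |y| < 1) :
    HasSum (fun n => Ring.multichoose (1 / 2 : ℝ) n * y ^ n) (1 / √(1 - y)) := by
  have h := (one_div_one_sub_rpow_hasFPowerSeriesOnBall_zero (1 / 2)).hasSum (y := y)
    (by simpa [enorm_eq_nnnorm, ← NNReal.coe_lt_coe] using hy)
  rw [sqrt_eq_rpow]
  rw [zero_add] at h
  refine h.congr_fun fun n => ?_
  rw [FormalMultilinearSeries.ofScalars_apply_eq, smul_eq_mul, Ring.choose]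
  congr 2
  ring

/-- Termwise lower bound for a combination of arcsines all of whose odd moments are nonnegative. -/
theorem sum_arcsin_ge {ι : Type*} (s : Finset ι) (a ρ : ι → ℝ) (hρ : ∀ p ∈ s, |ρ p| ≤ 1)
    (hpos : ∀ k, 0 ≤ ∑ p ∈ s, a p * ρ p ^ (2 * k + 1)) (k : ℕ) :
    (1 / 2 : ℝ) ^ k / (2 * k + 1) * ∑ p ∈ s, a p * ρ p ^ (2 * k + 1)
      ≤ ∑ p ∈ s, a p * arcsin (ρ p) := by
  set S : ℕ → ℝ := fun k => ∑ p ∈ s, a p * ρ p ^ (2 * k + 1) with hS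
  -- Scaling all `ρ p` by `r` gives `F 0 = 0`, and the claim is `0 ≤ F 1`. On `(0, 1)` the
  -- derivative of the arcsine sum is a power series in `r` with nonnegative terms, whose `k`-th
  -- term alone dominates the subtracted one. Staying inside `(0, 1)` avoids the singularities of
  -- the derivative of arcsin at `±1`; continuity reaches `r = 1`.
  set F : ℝ → ℝ := fun r =>
    ∑ p ∈ s, a p * arcsin (r * ρ p) - (1 / 2 : ℝ) ^ k / (2 * k + 1) * S k * r ^ (2 * k + 1) with hF
  have hlt : ∀ r ∈ Ioo (0 : ℝ) 1, ∀ p ∈ s, |r * ρ p| < 1 := by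
    intro r hr p hp
    rw [abs_mul, abs_of_pos hr.1]
    nlinarith [hρ p hp, abs_nonneg (ρ p), hr.1, hr.2]
  have hder : ∀ r ∈ Ioo (0 : ℝ) 1, HasDerivAt F
      (∑ p ∈ s, a p * (1 / √(1 - (r * ρ p) ^ 2) * ρ p) - (1 / 2 : ℝ) ^ k * S k * r ^ (2 * k)) r := by
    intro r hr
    refine HasDerivAt.sub (HasDerivAt.fun_sum fun p hp => HasDerivAt.const_mul _ ?_) ?_
    · have hb := abs_lt.1 (hlt r hr p hp)
      have h1 : HasDerivAt (fun r : ℝ => r * ρ p) (ρ p) r := by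
        simpa using (hasDerivAt_id r).mul_const (ρ p)
      exact (hasDerivAt_arcsin hb.1.ne' hb.2.ne).comp r h1
    · have h1 := (hasDerivAt_pow (2 * k + 1) r).const_mul ((1 / 2 : ℝ) ^ k / (2 * k + 1) * S k)
      have h2 : (1 / 2 : ℝ) ^ k * S k * r ^ (2 * k) = (1 / 2 : ℝ) ^ k / (2 * k + 1) * S k *
          (((2 * k + 1 : ℕ) : ℝ) * r ^ (2 * k + 1 - 1)) := by
        rw [Nat.add_sub_cancel]
        push_cast
        field_simp
      rw [h2]
      exact h1
  have hnn : ∀ r ∈ Ioo (0 : ℝ) 1,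
      0 ≤ ∑ p ∈ s, a p * (1 / √(1 - (r * ρ p) ^ 2) * ρ p) - (1 / 2 : ℝ) ^ k * S k * r ^ (2 * k) := by
    intro r hr
    have hsum : HasSum (fun n => Ring.multichoose (1 / 2 : ℝ) n * r ^ (2 * n) * S n)
        (∑ p ∈ s, a p * (1 / √(1 - (r * ρ p) ^ 2) * ρ p)) := by
      have := hasSum_sum (s := s) (fun p hp =>
        (((hasSum_one_div_sqrt_one_sub (y := (r * ρ p) ^ 2) (by
          rw [abs_pow]
          exact pow_lt_one₀ (abs_nonneg _) (hlt r hr p hp) two_ne_zero)).mul_right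
            (ρ p)).mul_left (a p)))
      refine this.congr_fun fun n => ?_
      simp only [hS, Finset.mul_sum]
      refine Finset.sum_congr rfl fun p _ => ?_
      ring
    have h1 := le_hasSum hsum k fun n _ => mul_nonneg (mul_nonneg
      (le_trans (by positivity) (multichoose_half_ge n)) (pow_nonneg hr.1.le _)) (hpos n)
    have h2 : (1 / 2 : ℝ) ^ k * S k * r ^ (2 * k)
        ≤ Ring.multichoose (1 / 2 : ℝ) k * r ^ (2 * k) * S k := by
      rw [mul_right_comm]
      exact mul_le_mul_of_nonneg_right
        (mul_le_mul_of_nonneg_right (multichoose_half_ge k) (pow_nonneg hr.1.le _)) (hpos k)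
    linarith
  have hmono : MonotoneOn F (Icc 0 1) := by
    refine monotoneOn_of_deriv_nonneg (convex_Icc 0 1) ?_ ?_ ?_
    · apply Continuous.continuousOn
      have := continuous_arcsin
      fun_prop
    · rw [interior_Icc]
      exact fun r hr => (hder r hr).differentiableAt.differentiableWithinAt
    · rw [interior_Icc]
      intro r hr
      rw [(hder r hr).deriv]
      exact hnn r hr
  have := hmono (left_mem_Icc.2 zero_le_one) (right_mem_Icc.2 zero_le_one) zero_le_one
  simp only [hF, zero_mul, arcsin_zero, mul_zero, Finset.sum_const_zero, one_mul, one_pow,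
    mul_one] at this
  rw [zero_pow (by lia)] at this
  simp only [hS] at this ⊢
  linarith

end ArcsinKernel

/-! ### Moments of Gram kernels in dimension `d` -/

section Moments

theorem sum_mul_feature_kernel {κ S : Type*} [Fintype κ] (s : Finset S) (w : κ → ℝ)
    (φ : S → κ → ℝ) :
    ∑ i, ∑ j, w i * w j * ∑ a ∈ s, φ a i * φ a j = ∑ a ∈ s, (∑ i, w i * φ a i) ^ 2 := by
  simp_rw [sq, Finset.sum_mul_sum, Finset.mul_sum]
  rw [Finset.sum_comm (s := s)]
  refine Finset.sum_congr rfl fun i _ => ?_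
  rw [Finset.sum_comm]
  exact Finset.sum_congr rfl fun a _ => Finset.sum_congr rfl fun j _ => by ring

/-- The squared kernel has the products `φ a * φ b` as features, so its form is a sum of squares
over pairs `(a, b)`. Keeping only the diagonal pairs and applying Cauchy–Schwarz over `s` yields the
factor `s.card`. -/
theorem sum_mul_feature_kernel_sq_ge {κ S : Type*} [Fintype κ] (s : Finset S) (w : κ → ℝ)
    (φ : S → κ → ℝ) :
    (∑ i, w i * ∑ a ∈ s, φ a i * φ a i) ^ 2
      ≤ s.card * ∑ i, ∑ j, w i * w j * (∑ a ∈ s, φ a i * φ a j) ^ 2 := by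
  have h1 : ∑ i, ∑ j, w i * w j * (∑ a ∈ s, φ a i * φ a j) ^ 2
      = ∑ p ∈ s ×ˢ s, (∑ i, w i * (φ p.1 i * φ p.2 i)) ^ 2 := by
    rw [← sum_mul_feature_kernel (s ×ˢ s) w (fun p i => φ p.1 i * φ p.2 i)]
    refine Finset.sum_congr rfl fun i _ => Finset.sum_congr rfl fun j _ => ?_
    rw [sq, Finset.sum_mul_sum, Finset.sum_product]
    congr 1
    refine Finset.sum_congr rfl fun a _ => Finset.sum_congr rfl fun b _ => ?_
    ring
  have h2 : ∑ a ∈ s, (∑ i, w i * (φ a i * φ a i)) ^ 2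
      ≤ ∑ p ∈ s ×ˢ s, (∑ i, w i * (φ p.1 i * φ p.2 i)) ^ 2 := by
    rw [Finset.sum_product]
    refine Finset.sum_le_sum fun a ha => ?_
    exact Finset.single_le_sum (f := fun b => (∑ i, w i * (φ a i * φ b i)) ^ 2)
      (fun b _ => sq_nonneg _) ha
  have h3 : ∑ i, w i * ∑ a ∈ s, φ a i * φ a i = ∑ a ∈ s, ∑ i, w i * (φ a i * φ a i) := by
    simp_rw [Finset.mul_sum]
    exact Finset.sum_comm
  rw [h3, h1]
  exact sq_sum_le_card_mul_sum_sq.trans (mul_le_mul_of_nonneg_left h2 (Nat.cast_nonneg _))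

variable {d : ℕ}

/-- Monomial features of the `k`-th power of the inner product. -/
theorem exists_feature_inner_pow {κ : Type*} (u : κ → EuclideanSpace ℝ (Fin d)) (k : ℕ) :
    ∃ φ : Sym (Fin d) k → κ → ℝ, ∀ i j, ⟪u i, u j⟫ ^ k = ∑ a, φ a i * φ a j := by
  refine ⟨fun a i => √((a : Multiset (Fin d)).countPerms) *
    ((a : Multiset (Fin d)).map fun c => u i c).prod, fun i j => ?_⟩
  rw [PiLp.inner_apply]
  simp only [RCLike.inner_apply, conj_trivial]
  rw [Finset.sum_pow, Finset.sym_univ]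
  refine Finset.sum_congr rfl fun a _ => ?_
  rw [Multiset.prod_map_mul, mul_mul_mul_comm, mul_self_sqrt (Nat.cast_nonneg _), mul_comm (Multiset.prod _)]
  rfl

variable {κ : Type*} [Fintype κ]

theorem sum_inner_pow_nonneg (u : κ → EuclideanSpace ℝ (Fin d)) (w : κ → ℝ) (k : ℕ) :
    0 ≤ ∑ i, ∑ j, w i * w j * ⟪u i, u j⟫ ^ k := by
  obtain ⟨φ, hφ⟩ := exists_feature_inner_pow u k
  simp_rw [hφ]
  rw [sum_mul_feature_kernel]
  positivity

/-- The features are the monomials of degree `k` in `d` variables, `d.multichoose k` in number; on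
unit vectors the diagonal of the kernel is `1`. -/
theorem sum_inner_pow_even_ge {u : κ → EuclideanSpace ℝ (Fin d)} (hu : ∀ i, ‖u i‖ = 1)
    (w : κ → ℝ) (k : ℕ) :
    (∑ i, w i) ^ 2 ≤ d.multichoose k * ∑ i, ∑ j, w i * w j * ⟪u i, u j⟫ ^ (2 * k) := by
  obtain ⟨φ, hφ⟩ := exists_feature_inner_pow u k
  have := sum_mul_feature_kernel_sq_ge Finset.univ w φ
  simp_rw [← hφ, real_inner_self_eq_norm_sq, hu, ← pow_mul, mul_comm k 2] at this
  simpa [Sym.card_sym_eq_multichoose] using this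

theorem multichoose_le_two_pow (d k : ℕ) : d.multichoose k ≤ 2 ^ (d + k) := by
  rw [Nat.multichoose_eq]
  exact (Nat.choose_le_two_pow _ _).trans (Nat.pow_le_pow_right two_pos (by lia))

theorem two_mul_add_five_le_two_pow (d : ℕ) : 2 * (d + 2) + 1 ≤ 2 ^ (d + 3) := by
  induction d with
  | zero => norm_num
  | succ d ih => rw [show d + 1 + 3 = d + 3 + 1 by ring, pow_succ]; lia

/-- Only the Taylor term of degree `2d + 5` is kept and compared with the even power `2d + 6`. That
degree is chosen so that the comparison error `2^{-(2d+4)}` is half of the lower bound `2^{-(2d+3)}`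
for the even moment. -/
theorem sum_arcsin_inner_ge {u : κ → EuclideanSpace ℝ (Fin d)} (hu : ∀ i, ‖u i‖ = 1)
    (hang : ∀ i j, -(1 / 2) ≤ ⟪u i, u j⟫) {w : κ → ℝ} (hw : ∀ i, 0 ≤ w i) :
    (1 / 2 : ℝ) ^ (4 * d + 9) * (∑ i, w i) ^ 2 ≤ ∑ i, ∑ j, w i * w j * arcsin ⟪u i, u j⟫ := by
  have habs : ∀ i j, |⟪u i, u j⟫| ≤ 1 := fun i j => by
    simpa [hu] using abs_real_inner_le_norm (u i) (u j)
  have h1 := sum_arcsin_ge (Finset.univ ×ˢ Finset.univ) (fun p : κ × κ => w p.1 * w p.2)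
    (fun p => ⟪u p.1, u p.2⟫) (fun p _ => habs p.1 p.2) (fun k => by
      rw [Finset.sum_product]; exact sum_inner_pow_nonneg u w _) (d + 2)
  rw [Finset.sum_product, Finset.sum_product] at h1
  refine le_trans ?_ h1
  have h2 := sum_inner_pow_even_ge hu w (d + 3)
  set T := ∑ i, ∑ j, w i * w j * ⟪u i, u j⟫ ^ (2 * (d + 3)) with hT
  have hT0 : 0 ≤ T := sum_inner_pow_nonneg u w _
  have h3 : (1 / 2 : ℝ) ^ (2 * d + 3) * (∑ i, w i) ^ 2 ≤ T := by
    have hm : (d.multichoose (d + 3) : ℝ) ≤ 2 ^ (2 * d + 3) := by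
      have := multichoose_le_two_pow d (d + 3)
      rw [show d + (d + 3) = 2 * d + 3 by ring] at this
      exact_mod_cast this
    have := h2.trans (mul_le_mul_of_nonneg_right hm hT0)
    rw [one_div, inv_pow, inv_mul_le_iff₀ (by positivity)]
    exact this
  have h4 : T - (1 / 2 : ℝ) ^ (2 * d + 4) * (∑ i, w i) ^ 2
      ≤ ∑ i, ∑ j, w i * w j * ⟪u i, u j⟫ ^ (2 * (d + 2) + 1) := by
    rw [hT, sq, Finset.sum_mul_sum, Finset.mul_sum, ← Finset.sum_sub_distrib]
    refine Finset.sum_le_sum fun i _ => ?_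
    rw [Finset.mul_sum, ← Finset.sum_sub_distrib]
    refine Finset.sum_le_sum fun j _ => ?_
    set ρ := ⟪u i, u j⟫ with hρ
    have hb := abs_le.1 (habs i j)
    -- For `ρ ≥ 0` the odd power is already the larger one. For `ρ < 0` the hypothesis gives `|ρ| ≤
    -- 1/2`, so the common factor `ρ^(2d+4)` is tiny while `ρ² - ρ ≤ 1`.
    have key : ρ ^ (2 * (d + 3)) - (1 / 2) ^ (2 * d + 4) ≤ ρ ^ (2 * (d + 2) + 1) := by
      have e1 : ρ ^ (2 * (d + 3)) = (ρ ^ (d + 2)) ^ 2 * ρ ^ 2 := by ring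
      have e2 : ρ ^ (2 * (d + 2) + 1) = (ρ ^ (d + 2)) ^ 2 * ρ := by ring
      rw [e1, e2]
      rcases le_or_gt 0 ρ with h | h
      · have := mul_le_mul_of_nonneg_left (show ρ ^ 2 ≤ ρ by nlinarith) (sq_nonneg (ρ ^ (d + 2)))
        have h0 : (0 : ℝ) ≤ (1 / 2) ^ (2 * d + 4) := by positivity
        linarith
      · have hs : (ρ ^ (d + 2)) ^ 2 ≤ (1 / 2) ^ (2 * d + 4) := by
          rw [← pow_mul, mul_comm, pow_mul, show 2 * d + 4 = 2 * (d + 2) by ring, pow_mul]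
          exact pow_le_pow_left₀ (sq_nonneg _) (by nlinarith [hang i j]) _
        have := mul_le_mul_of_nonneg_left (show ρ ^ 2 - ρ ≤ 1 by nlinarith [hang i j])
          (sq_nonneg (ρ ^ (d + 2)))
        linarith
    calc _ = w i * w j * (ρ ^ (2 * (d + 3)) - (1 / 2) ^ (2 * d + 4)) := by ring
      _ ≤ _ := mul_le_mul_of_nonneg_left key (mul_nonneg (hw i) (hw j))
  have h5 : (1 / 2 : ℝ) ^ (2 * d + 4) * (∑ i, w i) ^ 2
      ≤ ∑ i, ∑ j, w i * w j * ⟪u i, u j⟫ ^ (2 * (d + 2) + 1) := by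
    rw [pow_succ] at h4 ⊢
    linarith
  have h6 : (1 / 2 : ℝ) ^ (2 * d + 5) ≤ (1 / 2 : ℝ) ^ (d + 2) / (2 * (d + 2 : ℕ) + 1) := by
    rw [le_div_iff₀ (by positivity), show 2 * d + 5 = (d + 2) + (d + 3) by ring, pow_add, mul_assoc]
    refine mul_le_of_le_one_right (by positivity) ?_
    rw [one_div, inv_pow, inv_mul_le_iff₀ (by positivity), mul_one]
    exact_mod_cast two_mul_add_five_le_two_pow d
  calc (1 / 2 : ℝ) ^ (4 * d + 9) * (∑ i, w i) ^ 2
      = (1 / 2 : ℝ) ^ (2 * d + 5) * ((1 / 2 : ℝ) ^ (2 * d + 4) * (∑ i, w i) ^ 2) := by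
        rw [← mul_assoc, ← pow_add]; congr 2; ring
    _ ≤ _ := mul_le_mul h6 h5 (by positivity) (by positivity)

end Moments

/-! ### Weighted sums of Gaussian signs -/

section SignSums

/-- The sign of a real number, with the sign of `0` equal to `1`. -/
noncomputable def sgn (t : ℝ) : ℝ := if 0 ≤ t then 1 else -1

theorem measurable_sgn : Measurable sgn :=
  Measurable.ite measurableSet_Ici measurable_const measurable_const

theorem abs_sgn (t : ℝ) : |sgn t| = 1 := by
  unfold sgn; split_ifs <;> simp

theorem sgn_mul_of_pos {c : ℝ} (hc : 0 < c) (t : ℝ) : sgn (c * t) = sgn t := by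
  simp [sgn, mul_nonneg_iff_of_pos_left hc]

theorem sgn_mul_sgn (s t : ℝ) :
    sgn s * sgn t = 1 - 2 * if ¬ (0 ≤ s ↔ 0 ≤ t) then 1 else 0 := by
  unfold sgn
  by_cases hs : 0 ≤ s <;> by_cases ht : 0 ≤ t <;> simp [hs, ht] <;> norm_num

variable {E : Type*} [NormedAddCommGroup E] [InnerProductSpace ℝ E] [FiniteDimensional ℝ E]
  [MeasurableSpace E] [BorelSpace E]

@[fun_prop]
theorem measurable_sgn_inner (u : E) : Measurable fun x : E => sgn ⟪x, u⟫ :=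
  measurable_sgn.comp (by fun_prop)

theorem integral_indicator_sign_ne {u v : E} (hu : ‖u‖ = 1) (hv : ‖v‖ = 1) :
    ∫ x, (if ¬ (0 ≤ ⟪x, u⟫ ↔ 0 ≤ ⟪x, v⟫) then (1 : ℝ) else 0) ∂stdGaussian E
      = arccos ⟪u, v⟫ / π := by
  rw [← stdGaussian_sign_ne hu hv, ← integral_indicator_one
    (measurableSet_sign_ne (by fun_prop) (by fun_prop))]
  refine integral_congr_ae (ae_of_all _ fun x => ?_)
  simp [indicator_apply]

theorem integrable_of_measurable_of_bound {f : E → ℝ} (hf : Measurable f) (C : ℝ)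
    (hC : ∀ x, |f x| ≤ C) : Integrable f (stdGaussian E) :=
  Integrable.of_bound hf.aestronglyMeasurable C (ae_of_all _ hC)

theorem integral_sgn_mul_sgn {u v : E} (hu : ‖u‖ = 1) (hv : ‖v‖ = 1) :
    ∫ x, sgn ⟪x, u⟫ * sgn ⟪x, v⟫ ∂stdGaussian E = 2 / π * arcsin ⟪u, v⟫ := by
  simp_rw [sgn_mul_sgn]
  rw [integral_sub (integrable_const _), integral_const_mul, integral_indicator_sign_ne hu hv,
    integral_const, probReal_univ, arccos_eq_pi_div_two_sub_arcsin]
  · have := pi_ne_zero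
    simp only [smul_eq_mul]
    field_simp
    ring
  · refine Integrable.const_mul (integrable_of_measurable_of_bound ?_ 1 ?_) _
    · exact Measurable.ite (measurableSet_sign_ne (by fun_prop) (by fun_prop))
        measurable_const measurable_const
    · intro x; split_ifs <;> simp

theorem abs_sum_sgn_le {κ : Type*} [Fintype κ] (s : κ → ℝ) {w : κ → ℝ} (hw : ∀ i, 0 ≤ w i) :
    |∑ i, w i * sgn (s i)| ≤ ∑ i, w i := by
  refine (Finset.abs_sum_le_sum_abs _ _).trans (Finset.sum_le_sum fun i _ => ?_)
  rw [abs_mul, abs_sgn, mul_one, abs_of_nonneg (hw i)]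

theorem integral_sq_sum_sgn {κ : Type*} [Fintype κ] {u : κ → E} (hu : ∀ i, ‖u i‖ = 1)
    (w : κ → ℝ) :
    ∫ x, (∑ i, w i * sgn ⟪x, u i⟫) ^ 2 ∂stdGaussian E
      = 2 / π * ∑ i, ∑ j, w i * w j * arcsin ⟪u i, u j⟫ := by
  have hI : ∀ i j, Integrable (fun x => w i * w j * (sgn ⟪x, u i⟫ * sgn ⟪x, u j⟫))
      (stdGaussian E) := fun i j =>
    (integrable_of_measurable_of_bound (by fun_prop) 1 fun x => by
      rw [abs_mul, abs_sgn, abs_sgn, one_mul]).const_mul _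
  have h1 : ∀ x : E, (∑ i, w i * sgn ⟪x, u i⟫) ^ 2
      = ∑ i, ∑ j, w i * w j * (sgn ⟪x, u i⟫ * sgn ⟪x, u j⟫) := fun x => by
    rw [sq, Finset.sum_mul_sum]
    exact Finset.sum_congr rfl fun i _ => Finset.sum_congr rfl fun j _ => by ring
  simp_rw [h1]
  rw [integral_finsetSum _ fun i _ => integrable_finsetSum _ fun j _ => hI i j, Finset.mul_sum]
  refine Finset.sum_congr rfl fun i _ => ?_
  rw [integral_finsetSum _ fun j _ => hI i j, Finset.mul_sum]
  refine Finset.sum_congr rfl fun j _ => ?_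
  rw [integral_const_mul, integral_sgn_mul_sgn (hu i) (hu j)]
  ring

/-- A weighted sum of signs is large on average if no two of the vectors are almost opposite. -/
theorem integral_abs_sum_sgn_ge {d : ℕ} {κ : Type*} [Fintype κ] {b : κ → EuclideanSpace ℝ (Fin d)}
    (hb : ∀ i, b i ≠ 0) (hang : ∀ i j, -(1 / 2) * (‖b i‖ * ‖b j‖) ≤ ⟪b i, b j⟫)
    {w : κ → ℝ} (hw : ∀ i, 0 ≤ w i) :
    (1 / 2 : ℝ) ^ (4 * d + 10) * ∑ i, w i
      ≤ ∫ x, |∑ i, w i * sgn ⟪x, b i⟫| ∂stdGaussian (EuclideanSpace ℝ (Fin d)) := by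
  set u : κ → EuclideanSpace ℝ (Fin d) := fun i => ‖b i‖⁻¹ • b i with hu'
  have hpos : ∀ i, 0 < ‖b i‖ := fun i => norm_pos_iff.2 (hb i)
  have hu : ∀ i, ‖u i‖ = 1 := fun i => by
    rw [hu', norm_smul, norm_inv, norm_norm, inv_mul_cancel₀ (hpos i).ne']
  have hsgn : ∀ i (x : EuclideanSpace ℝ (Fin d)), sgn ⟪x, b i⟫ = sgn ⟪x, u i⟫ := fun i x => by
    rw [hu', inner_smul_right, sgn_mul_of_pos (inv_pos.2 (hpos i))]
  simp_rw [hsgn]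
  have hangu : ∀ i j, -(1 / 2) ≤ ⟪u i, u j⟫ := fun i j => by
    rw [hu', inner_smul_left, inner_smul_right, RCLike.conj_to_real, ← mul_assoc, ← mul_inv,
      ← div_eq_inv_mul, le_div_iff₀ (mul_pos (hpos i) (hpos j))]
    exact hang i j
  set W := ∑ i, w i with hW
  have hW0 : 0 ≤ W := Finset.sum_nonneg fun i _ => hw i
  rcases hW0.eq_or_lt with h0 | h0
  · rw [← h0, mul_zero]
    exact integral_nonneg fun x => abs_nonneg _
  have hm : Measurable fun x : EuclideanSpace ℝ (Fin d) => ∑ i, w i * sgn ⟪x, u i⟫ := by fun_prop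
  have h1 := sum_arcsin_inner_ge hu hangu hw
  have h2 := integral_sq_sum_sgn hu w
  -- The sum is bounded by `W`, so its square is at most `W` times its absolute value: the second
  -- moment controls the first from below. The bound `2/π ≥ 1/2` then costs the last factor `1/2`.
  have h3 : ∫ x, (∑ i, w i * sgn ⟪x, u i⟫) ^ 2 ∂stdGaussian (EuclideanSpace ℝ (Fin d))
      ≤ ∫ x, W * |∑ i, w i * sgn ⟪x, u i⟫| ∂stdGaussian (EuclideanSpace ℝ (Fin d)) := by
    have hle := fun x : EuclideanSpace ℝ (Fin d) => abs_sum_sgn_le (fun i => ⟪x, u i⟫) hw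
    refine integral_mono (integrable_of_measurable_of_bound (by fun_prop) (W ^ 2) fun x => ?_)
      (integrable_of_measurable_of_bound (by fun_prop) (W * W) fun x => ?_) fun x => ?_
    · rw [abs_pow]
      exact pow_le_pow_left₀ (abs_nonneg _) (hle x) 2
    · rw [abs_mul, abs_abs, abs_of_nonneg hW0]
      exact mul_le_mul_of_nonneg_left (hle x) hW0
    · simp only
      rw [← sq_abs, sq]
      exact mul_le_mul_of_nonneg_right (hle x) (abs_nonneg _)
  rw [integral_const_mul, h2] at h3
  have h4 : (1 / 2 : ℝ) ≤ 2 / π := by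
    rw [div_le_div_iff₀ two_pos pi_pos]; linarith [pi_lt_four]
  have h5 : (1 / 2 : ℝ) * ((1 / 2 : ℝ) ^ (4 * d + 9) * W ^ 2)
      ≤ 2 / π * ∑ i, ∑ j, w i * w j * arcsin ⟪u i, u j⟫ :=
    mul_le_mul h4 h1 (by positivity) (by positivity)
  refine le_of_mul_le_mul_left (a := W) ?_ h0
  refine le_trans (le_of_eq ?_) (h5.trans h3)
  ring

end SignSums
end MaxCut

namespace MaxCut
open MeasureTheory ProbabilityTheory Real Set

/-! ### The gain from simultaneous flips -/

section Flip

variable {n d : ℕ}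

/-- The label of hyperplane rounding with normal vector `x`. -/
noncomputable def label (v : Fin n → EuclideanSpace ℝ (Fin d)) (x : EuclideanSpace ℝ (Fin d))
    (i : Fin n) : ℤˣ := if 0 ≤ ⟪x, v i⟫ then 1 else -1

/-- Weight of the edges from `i` to vertices away from the boundary with the same label. -/
noncomputable def stableWeight (G : WeightedGraph n) (v : Fin n → EuclideanSpace ℝ (Fin d)) (ε : ℝ)
    (x : EuclideanSpace ℝ (Fin d)) (i : Fin n) : ℝ :=
  ∑ j, if label v x j = label v x i ∧ ε ≤ |⟪x, v j⟫| then G.weight i j else 0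

/-- Weight of the edges at `i` cut by hyperplane rounding. -/
noncomputable def crossWeight (G : WeightedGraph n) (v : Fin n → EuclideanSpace ℝ (Fin d))
    (x : EuclideanSpace ℝ (Fin d)) (i : Fin n) : ℝ :=
  ∑ j, if label v x j ≠ label v x i then G.weight i j else 0

/-- Hyperplane rounding followed by the flips of all vertices near the boundary for which
`crossWeight` is smaller than `stableWeight`. -/
noncomputable def flipLabel (G : WeightedGraph n) (v : Fin n → EuclideanSpace ℝ (Fin d)) (ε : ℝ)
    (x : EuclideanSpace ℝ (Fin d)) (i : Fin n) : ℤˣ :=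
  if |⟪x, v i⟫| < ε ∧ crossWeight G v x i < stableWeight G v ε x i then -label v x i
  else label v x i

theorem sum_Ioi_eq_half {f : Fin n → Fin n → ℝ} (hs : ∀ i j, f i j = f j i)
    (h0 : ∀ i, f i i = 0) : ∑ i, ∑ j ∈ Finset.Ioi i, f i j = 1 / 2 * ∑ i, ∑ j, f i j := by
  have h1 : ∑ i, ∑ j ∈ Finset.Iio i, f i j = ∑ i, ∑ j ∈ Finset.Ioi i, f i j := by
    rw [Finset.sum_comm' (t' := Finset.univ) (s' := fun j => Finset.Ioi j) (by simp)]
    exact Finset.sum_congr rfl fun i _ => Finset.sum_congr rfl fun j _ => hs _ _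
  have h2 : ∀ i, ∑ j, f i j = ∑ j ∈ Finset.Iio i, f i j + ∑ j ∈ Finset.Ioi i, f i j := fun i => by
    rw [← Finset.sum_union]
    · refine (Finset.sum_subset (Finset.subset_univ _) fun j _ hj => ?_).symm
      have : j = i := by
        simp only [Finset.mem_union, Finset.mem_Iio, Finset.mem_Ioi] at hj
        lia
      rw [this, h0]
    · rw [Finset.disjoint_left]
      intro j h1 h2
      simp only [Finset.mem_Iio, Finset.mem_Ioi] at h1 h2
      lia
  simp_rw [h2]
  rw [Finset.sum_add_distrib, h1]
  ring

theorem cutWeight_eq_half (G : WeightedGraph n) (x : Fin n → ℤˣ) :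
    cutWeight G x = 1 / 2 * ∑ i, ∑ j, if x i ≠ x j then G.weight i j else 0 :=
  sum_Ioi_eq_half (fun i j => by simp only [ne_comm, G.symm]) (fun i => by simp)

theorem sdpValue_eq_quarter (G : WeightedGraph n) (v : Fin n → EuclideanSpace ℝ (Fin d)) :
    sdpValue G v = 1 / 2 * ∑ i, ∑ j, G.weight i j * ((1 - ⟪v i, v j⟫) / 2) := by
  rw [sdpValue, sum_Ioi_eq_half (fun i j => by rw [G.symm, real_inner_comm])
    (fun i => by rw [G.loopless, zero_mul])]
  simp_rw [← mul_div_assoc, ← Finset.sum_div]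
  ring

/-- Local flips gain at least the sum of the individual surpluses. -/
theorem cutWeight_flipLabel_ge (G : WeightedGraph n) (v : Fin n → EuclideanSpace ℝ (Fin d))
    (ε : ℝ) (x : EuclideanSpace ℝ (Fin d)) :
    cutWeight G (label v x) + ∑ i, (if |⟪x, v i⟫| < ε then
      max (stableWeight G v ε x i - crossWeight G v x i) 0 else 0)
      ≤ cutWeight G (flipLabel G v ε x) := by
  set F : Fin n → Prop := fun i =>
    |⟪x, v i⟫| < ε ∧ crossWeight G v x i < stableWeight G v ε x i with hF
  classical
  set c : Fin n → Fin n → ℝ := fun i j =>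
    (if label v x j = label v x i ∧ ε ≤ |⟪x, v j⟫| then G.weight i j else 0)
      - (if label v x j ≠ label v x i then G.weight i j else 0) with hc
  have h1 : ∀ i, (if |⟪x, v i⟫| < ε then
      max (stableWeight G v ε x i - crossWeight G v x i) 0 else 0)
      = ∑ j, if F i then c i j else 0 := fun i => by
    by_cases h : F i
    · simp only [h, if_true]
      rw [if_pos h.1, max_eq_left (by linarith [h.2]), stableWeight, crossWeight,
        ← Finset.sum_sub_distrib]
    · simp only [h, if_false, Finset.sum_const_zero]
      split_ifs with h2
      · exact max_eq_right (by linarith [not_lt.1 fun h3 => h ⟨h2, h3⟩])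
      · rfl
  simp_rw [h1]
  rw [cutWeight_eq_half, cutWeight_eq_half]
  have h2 : ∑ i, ∑ j, (if F i then c i j else 0)
      = 1 / 2 * ∑ i, ∑ j, ((if F i then c i j else 0) + if F j then c j i else 0) := by
    simp_rw [Finset.sum_add_distrib]
    rw [Finset.sum_comm (f := fun i j => if F j then c j i else 0)]
    ring
  rw [h2, ← mul_add, ← Finset.sum_add_distrib]
  refine mul_le_mul_of_nonneg_left (Finset.sum_le_sum fun i _ => ?_) (by norm_num)
  rw [← Finset.sum_add_distrib]
  refine Finset.sum_le_sum fun j _ => ?_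
  have hfl : ∀ i, flipLabel G v ε x i = if F i then -label v x i else label v x i := fun i => by
    rw [flipLabel]
  have hw := G.nonneg i j
  have hsg : ∀ a b : ℤˣ, (a = -b ↔ a ≠ b) := by decide
  have hsg' : ∀ a b : ℤˣ, (-a = b ↔ a ≠ b) := by decide
  -- This settles edges with both ends flipped: their cut status is unchanged, and a flipped vertex
  -- is never stable, so `c i j` and `c j i` are at most `0`. If only `i` is flipped, the change of
  -- the edge is at least `c i j`.
  have hcand : ∀ i, F i → ¬ ε ≤ |⟪x, v i⟫| := fun i h => not_le.2 h.1
  rw [hfl, hfl]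
  simp only [hc, G.symm j i]
  have hsym := eq_comm (a := label v x j) (b := label v x i)
  by_cases hi : F i <;> by_cases hj : F j <;> by_cases he : label v x i = label v x j <;>
    simp only [ne_eq, hi, hj, he, hsg, hsg', hsym, not_true_eq_false, not_false_eq_true, if_true,
      if_false, true_and, false_and, hcand] <;> (try split_ifs) <;> linarith

end Flip
end MaxCut

namespace MaxCut
open MeasureTheory ProbabilityTheory Real Set

/-! ### The surplus of a vertex as a signed sum over critical neighbours -/

section Surplus

variable {n d : ℕ}

/-- Inner products of endpoints for which the rounding ratio may be near its minimum. -/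
def IsCritical (ρ : ℝ) : Prop := -(49 / 50) < ρ ∧ ρ < -(1 / 3)

theorem label_eq_iff (v : Fin n → EuclideanSpace ℝ (Fin d)) (x : EuclideanSpace ℝ (Fin d))
    (i j : Fin n) : label v x i = label v x j ↔ (0 ≤ ⟪x, v i⟫ ↔ 0 ≤ ⟪x, v j⟫) := by
  unfold label
  by_cases hi : 0 ≤ ⟪x, v i⟫ <;> by_cases hj : 0 ≤ ⟪x, v j⟫ <;> simp [hi, hj]

/-- Here `t = ⟪x, v i⟫` and `s` is the part of `⟪x, v j⟫ = ρ t + s` coming from the orthogonal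
complement of `v i`. If `|s| ≥ 2ε`, the perturbation `ρ t` changes neither the sign nor the
stability, and the contribution is exactly `± w`; otherwise an error of `2w` is conceded. -/
theorem signed_weight_ge {t s ρ ε w : ℝ} (hw : 0 ≤ w) (hρ : |ρ| ≤ 1) (ht : |t| < ε) :
    w * (sgn t * sgn s) - 2 * (w * if |s| < 2 * ε then 1 else 0)
      ≤ (if (0 ≤ ρ * t + s ↔ 0 ≤ t) ∧ ε ≤ |ρ * t + s| then w else 0)
        - (if ¬ (0 ≤ ρ * t + s ↔ 0 ≤ t) then w else 0) := by
  have hmul : |ρ * t| < ε := by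
    rw [abs_mul]
    exact lt_of_le_of_lt (mul_le_of_le_one_left (abs_nonneg t) hρ) ht
  have hlhs : -w ≤ (if (0 ≤ ρ * t + s ↔ 0 ≤ t) ∧ ε ≤ |ρ * t + s| then w else 0)
        - (if ¬ (0 ≤ ρ * t + s ↔ 0 ≤ t) then w else 0) := by
    split_ifs <;> linarith
  by_cases hs : |s| < 2 * ε
  · rw [if_pos hs]
    refine le_trans ?_ hlhs
    have : sgn t * sgn s ≤ 1 := by
      refine (le_abs_self _).trans ?_
      rw [abs_mul, abs_sgn, abs_sgn, one_mul]
    nlinarith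
  · rw [if_neg hs, mul_zero, mul_zero, sub_zero]
    rw [abs_lt] at hmul
    rcases le_or_gt 0 s with h | h
    · rw [abs_of_nonneg h] at hs
      have hr : 0 ≤ ρ * t + s := by linarith
      have hr2 : ε ≤ |ρ * t + s| := by rw [abs_of_nonneg hr]; linarith
      unfold sgn
      by_cases h0 : 0 ≤ t <;> simp [h, hr, hr2, h0]
    · rw [abs_of_neg h] at hs
      have hr : ¬ 0 ≤ ρ * t + s := by linarith
      have hr2 : ε ≤ |ρ * t + s| := by rw [abs_of_neg (not_le.1 hr)]; linarith
      unfold sgn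
      by_cases h0 : 0 ≤ t <;> simp [not_le.2 h, hr, hr2, h0]

theorem sum_subtype_eq_sum_ite {ι : Type*} [Fintype ι] (p : ι → Prop) [DecidablePred p]
    (f : ι → ℝ) : ∑ j : {j // p j}, f j = ∑ j, if p j then f j else 0 := by
  rw [← Finset.sum_filter]
  exact (Finset.sum_subtype _ (by simp) f).symm

open Classical in
-- Critical neighbours are treated by `signed_weight_ge`. A noncritical neighbour can only hurt when
-- it is separated from `i`, and is charged its full weight then.
theorem stable_sub_cross_ge (G : WeightedGraph n) {v : Fin n → EuclideanSpace ℝ (Fin d)}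
    (hv : ∀ i, ‖v i‖ = 1) {ε : ℝ} (x : EuclideanSpace ℝ (Fin d)) (i : Fin n)
    (ht : |⟪x, v i⟫| < ε) :
    sgn ⟪x, v i⟫ * (∑ j : {j // IsCritical ⟪v i, v j⟫},
        G.weight i j * sgn ⟪x, v j - ⟪v i, v j⟫ • v i⟫)
      - 2 * (∑ j : {j // IsCritical ⟪v i, v j⟫},
        G.weight i j * if |⟪x, v j - ⟪v i, v j⟫ • v i⟫| < 2 * ε then 1 else 0)
      - ∑ j, (if IsCritical ⟪v i, v j⟫ then 0 else
        G.weight i j * if ¬ (0 ≤ ⟪x, v i⟫ ↔ 0 ≤ ⟪x, v j⟫) then 1 else 0)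
      ≤ stableWeight G v ε x i - crossWeight G v x i := by
  rw [sum_subtype_eq_sum_ite (fun j => IsCritical ⟪v i, v j⟫)
      (fun j => G.weight i j * sgn ⟪x, v j - ⟪v i, v j⟫ • v i⟫),
    sum_subtype_eq_sum_ite (fun j => IsCritical ⟪v i, v j⟫)
      (fun j => G.weight i j * if |⟪x, v j - ⟪v i, v j⟫ • v i⟫| < 2 * ε then 1 else 0),
    stableWeight, crossWeight, Finset.mul_sum, Finset.mul_sum, ← Finset.sum_sub_distrib,
    ← Finset.sum_sub_distrib, ← Finset.sum_sub_distrib]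
  refine Finset.sum_le_sum fun j _ => ?_
  simp only [ne_eq, label_eq_iff]
  have hw := G.nonneg i j
  by_cases hj : IsCritical ⟪v i, v j⟫
  · simp only [hj, if_true]
    have hρ : |⟪v i, v j⟫| ≤ 1 := by simpa [hv] using abs_real_inner_le_norm (v i) (v j)
    have := signed_weight_ge (s := ⟪x, v j - ⟪v i, v j⟫ • v i⟫) hw hρ ht
    have hs : ⟪v i, v j⟫ * ⟪x, v i⟫ + ⟪x, v j - ⟪v i, v j⟫ • v i⟫ = ⟪x, v j⟫ := by
      rw [inner_sub_right, inner_smul_right]; ring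
    rw [hs] at this
    refine le_trans (le_of_eq ?_) this
    ring
  · simp only [hj, if_false, mul_zero]
    by_cases h : 0 ≤ ⟪x, v i⟫ <;> by_cases h' : 0 ≤ ⟪x, v j⟫ <;> simp [h, h'] <;>
      split_ifs <;> simp [hw]

end Surplus

/-! ### Geometry of critical neighbours under the triangle inequalities -/

section CriticalNeighbours

variable {n d : ℕ} {v : Fin n → EuclideanSpace ℝ (Fin d)}

theorem IsFeasible.inner_ge (hv : IsFeasible v) (i j k : Fin n) :
    -1 - ⟪v i, v j⟫ - ⟪v i, v k⟫ ≤ ⟪v j, v k⟫ := by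
  have h := hv.triangle i j k (-1) (by simp) 1 (by simp) 1 (by simp)
  simp only [one_smul, neg_smul] at h
  rw [norm_sub_sq_real, norm_sub_sq_real, norm_sub_sq_real, norm_neg, hv.unit, hv.unit, hv.unit,
    inner_neg_left, inner_neg_left] at h
  linarith

theorem inner_self_eq_one (hv : IsFeasible v) (i : Fin n) : ⟪v i, v i⟫ = (1 : ℝ) := by
  rw [real_inner_self_eq_norm_sq, hv.unit, one_pow]

theorem inner_sub_inner_smul (hv : IsFeasible v) (i j : Fin n) :
    ⟪v i, v j - ⟪v i, v j⟫ • v i⟫ = (0 : ℝ) := by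
  rw [inner_sub_right, inner_smul_right, inner_self_eq_one hv]; ring

theorem inner_sub_sub_inner_smul (hv : IsFeasible v) (i j k : Fin n) :
    ⟪v j - ⟪v i, v j⟫ • v i, v k - ⟪v i, v k⟫ • v i⟫
      = ⟪v j, v k⟫ - ⟪v i, v j⟫ * ⟪v i, v k⟫ := by
  simp only [inner_sub_left, inner_sub_right, inner_smul_left, inner_smul_right,
    inner_self_eq_one hv, RCLike.conj_to_real]
  rw [real_inner_comm (v i) (v j)]
  ring

theorem norm_sq_sub_inner_smul (hv : IsFeasible v) (i j : Fin n) :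
    ‖v j - ⟪v i, v j⟫ • v i‖ ^ 2 = 1 - ⟪v i, v j⟫ ^ 2 := by
  rw [← real_inner_self_eq_norm_sq, inner_sub_sub_inner_smul hv, inner_self_eq_one hv]; ring

/-- The cutoff `-49/50` keeps the projected vector away from `0`, so that its Gaussian projection is
rarely below `2ε`. -/
theorem IsCritical.norm_ge (hv : IsFeasible v) {i j : Fin n} (h : IsCritical ⟪v i, v j⟫) :
    1 / 6 ≤ ‖v j - ⟪v i, v j⟫ • v i‖ := by
  have := norm_sq_sub_inner_smul hv i j
  have h2 : (1 / 6 : ℝ) ^ 2 ≤ ‖v j - ⟪v i, v j⟫ • v i‖ ^ 2 := by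
    rw [this]
    nlinarith [h.1, h.2]
  exact le_of_sq_le_sq h2 (norm_nonneg _)

/-- Projected to the orthogonal complement of `v i`, critical neighbours make angles of at most
`2π/3`. -/
theorem IsCritical.inner_ge (hv : IsFeasible v) {i j k : Fin n} (hj : IsCritical ⟪v i, v j⟫)
    (hk : IsCritical ⟪v i, v k⟫) :
    -(1 / 2) * (‖v j - ⟪v i, v j⟫ • v i‖ * ‖v k - ⟪v i, v k⟫ • v i‖)
      ≤ ⟪v j - ⟪v i, v j⟫ • v i, v k - ⟪v i, v k⟫ • v i⟫ := by
  rw [inner_sub_sub_inner_smul hv]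
  have ht := hv.inner_ge i j k
  have hnj := norm_sq_sub_inner_smul hv i j
  have hnk := norm_sq_sub_inner_smul hv i k
  obtain ⟨hj1, hj2⟩ := hj
  obtain ⟨hk1, hk2⟩ := hk
  generalize ⟪v i, v j⟫ = p at *
  generalize ⟪v i, v k⟫ = q at *
  have ha : 0 ≤ ‖v j - p • v i‖ := norm_nonneg _
  have hb : 0 ≤ ‖v k - q • v i‖ := norm_nonneg _
  generalize ‖v j - p • v i‖ = a at *
  generalize ‖v k - q • v i‖ = b at *
  -- Since `a² = (1 - p)(1 + p)`, this says `1 + p ≤ (1 - p)/2`, that is `p ≤ -1/3`: the origin of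
  -- that cutoff. The triangle inequality bounds the projected inner product below by `-(1 + p)(1 +
  -- q)`.
  have h1 : (1 + p) ^ 2 ≤ 1 / 2 * a ^ 2 := by rw [hnj]; nlinarith
  have h2 : (1 + q) ^ 2 ≤ 1 / 2 * b ^ 2 := by rw [hnk]; nlinarith
  have h3 : (1 + p) * (1 + q) ≤ 1 / 2 * (a * b) := by
    refine le_of_sq_le_sq ?_ (by positivity)
    calc ((1 + p) * (1 + q)) ^ 2 = (1 + p) ^ 2 * (1 + q) ^ 2 := by ring
      _ ≤ (1 / 2 * a ^ 2) * (1 / 2 * b ^ 2) :=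
        mul_le_mul h1 h2 (sq_nonneg _) (by positivity)
      _ = _ := by ring
  nlinarith

end CriticalNeighbours

/-! ### Expected surplus of a vertex -/

section Expectation

theorem measurableSet_and {α : Type*} [MeasurableSpace α] {p q : α → Prop}
    (hp : MeasurableSet {a | p a}) (hq : MeasurableSet {a | q a}) :
    MeasurableSet {a | p a ∧ q a} := hp.inter hq

theorem integral_ite_one {E : Type*} [NormedAddCommGroup E] [InnerProductSpace ℝ E]
    [FiniteDimensional ℝ E] [MeasurableSpace E] [BorelSpace E] {p : E → Prop} [DecidablePred p]
    (hp : MeasurableSet {x | p x}) :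
    ∫ x, (if p x then (1 : ℝ) else 0) ∂stdGaussian E = (stdGaussian E).real {x | p x} := by
  rw [← integral_indicator_one hp]
  refine integral_congr_ae (ae_of_all _ fun x => ?_)
  simp [indicator_apply]

theorem stdGaussian_inner_lt_le {E : Type*} [NormedAddCommGroup E] [InnerProductSpace ℝ E]
    [FiniteDimensional ℝ E] [MeasurableSpace E] [BorelSpace E] {b : E} {c δ : ℝ} (hc : 0 < c)
    (hb : c ≤ ‖b‖) (hδ : 0 ≤ δ) : (stdGaussian E).real {x | |⟪x, b⟫| < δ} ≤ δ / c := by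
  have hb0 : 0 < ‖b‖ := hc.trans_le hb
  have hu : ‖‖b‖⁻¹ • b‖ = 1 := by rw [norm_smul, norm_inv, norm_norm, inv_mul_cancel₀ hb0.ne']
  refine le_trans (measureReal_mono fun x hx => ?_)
    (stdGaussian_inner_mem_le hu (div_nonneg hδ hc.le))
  simp only [mem_ofPred_eq, inner_smul_right, abs_mul, abs_inv, abs_norm] at hx ⊢
  rw [← div_eq_inv_mul, div_lt_div_iff₀ hb0 hc]
  calc |⟪x, b⟫| * c ≤ |⟪x, b⟫| * ‖b‖ := mul_le_mul_of_nonneg_left hb (abs_nonneg _)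
    _ < δ * ‖b‖ := mul_lt_mul_of_pos_right hx hb0

variable {n d : ℕ} {v : Fin n → EuclideanSpace ℝ (Fin d)}

@[fun_prop]
theorem measurable_stableWeight (G : WeightedGraph n) (v : Fin n → EuclideanSpace ℝ (Fin d))
    (ε : ℝ) (i : Fin n) : Measurable fun x => stableWeight G v ε x i := by
  unfold stableWeight
  simp only [label_eq_iff]
  refine Finset.measurable_sum _ fun j _ => Measurable.ite ?_ measurable_const measurable_const
  have hs : ∀ k, MeasurableSet {x | 0 ≤ ⟪x, v k⟫} := fun k =>
    measurableSet_le measurable_const (by fun_prop)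
  exact measurableSet_and ((hs j).iff (hs i)) (measurableSet_le measurable_const (by fun_prop))

@[fun_prop]
theorem measurable_crossWeight (G : WeightedGraph n) (v : Fin n → EuclideanSpace ℝ (Fin d))
    (i : Fin n) : Measurable fun x => crossWeight G v x i := by
  unfold crossWeight
  simp only [ne_eq, label_eq_iff]
  refine Finset.measurable_sum _ fun j _ => Measurable.ite ?_ measurable_const measurable_const
  exact measurableSet_sign_ne (by fun_prop) (by fun_prop)

theorem stableWeight_nonneg (G : WeightedGraph n) (v : Fin n → EuclideanSpace ℝ (Fin d)) (ε : ℝ)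
    (x : EuclideanSpace ℝ (Fin d)) (i : Fin n) : 0 ≤ stableWeight G v ε x i :=
  Finset.sum_nonneg fun j _ => by split_ifs; exacts [G.nonneg i j, le_rfl]

theorem stableWeight_le (G : WeightedGraph n) (v : Fin n → EuclideanSpace ℝ (Fin d)) (ε : ℝ)
    (x : EuclideanSpace ℝ (Fin d)) (i : Fin n) : stableWeight G v ε x i ≤ ∑ j, G.weight i j :=
  Finset.sum_le_sum fun j _ => by split_ifs; exacts [le_rfl, G.nonneg i j]

theorem crossWeight_nonneg (G : WeightedGraph n) (v : Fin n → EuclideanSpace ℝ (Fin d))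
    (x : EuclideanSpace ℝ (Fin d)) (i : Fin n) : 0 ≤ crossWeight G v x i :=
  Finset.sum_nonneg fun j _ => by split_ifs; exacts [G.nonneg i j, le_rfl]

/-- The gain of flipping the vertex `i` when it is near the boundary. -/
noncomputable def surplus (G : WeightedGraph n) (v : Fin n → EuclideanSpace ℝ (Fin d)) (ε : ℝ)
    (x : EuclideanSpace ℝ (Fin d)) (i : Fin n) : ℝ :=
  if |⟪x, v i⟫| < ε then max (stableWeight G v ε x i - crossWeight G v x i) 0 else 0

theorem surplus_nonneg (G : WeightedGraph n) (v : Fin n → EuclideanSpace ℝ (Fin d)) (ε : ℝ)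
    (x : EuclideanSpace ℝ (Fin d)) (i : Fin n) : 0 ≤ surplus G v ε x i := by
  unfold surplus
  split_ifs
  exacts [le_max_right _ _, le_rfl]

theorem integrable_surplus (G : WeightedGraph n) (v : Fin n → EuclideanSpace ℝ (Fin d)) (ε : ℝ)
    (i : Fin n) : Integrable (fun x => surplus G v ε x i) (stdGaussian _) := by
  refine integrable_of_measurable_of_bound ?_ (∑ j, G.weight i j) fun x => ?_
  · exact Measurable.ite (measurableSet_lt (by fun_prop) measurable_const) (by fun_prop)
      measurable_const
  · have h1 := stableWeight_le G v ε x i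
    have h2 := crossWeight_nonneg G v x i
    have h3 := (stableWeight_nonneg G v ε x i).trans h1
    rw [abs_of_nonneg (surplus_nonneg G v ε x i), surplus]
    split_ifs
    · exact max_le (by linarith) h3
    · exact h3

open Classical in
/-- Lower bound for the expected gain at a vertex. -/
theorem integral_surplus_ge (G : WeightedGraph n) (hv : IsFeasible v) {ε : ℝ} (hε : 0 < ε)
    (hεd : 480 * ε ≤ (1 / 2 : ℝ) ^ (4 * d + 10)) (i : Fin n) :
    ε * (1 / 2 : ℝ) ^ (4 * d + 10) / 20 *
        (∑ j, if IsCritical ⟪v i, v j⟫ then G.weight i j else 0)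
      - ∑ j, (if IsCritical ⟪v i, v j⟫ then 0 else G.weight i j * (arccos ⟪v i, v j⟫ / π))
      ≤ ∫ x, surplus G v ε x i ∂stdGaussian (EuclideanSpace ℝ (Fin d)) := by
  set γ := stdGaussian (EuclideanSpace ℝ (Fin d)) with hγ
  set δ : ℝ := (1 / 2 : ℝ) ^ (4 * d + 10) with hδ
  have hδ1 : δ ≤ 1 := pow_le_one₀ (by norm_num) (by norm_num)
  have hε1 : ε ≤ 1 := by linarith
  set b : {j // IsCritical ⟪v i, v j⟫} → EuclideanSpace ℝ (Fin d) :=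
    fun j => v j - ⟪v i, v j⟫ • v i with hb
  set w : {j // IsCritical ⟪v i, v j⟫} → ℝ := fun j => G.weight i j with hw'
  have hw : ∀ j, 0 ≤ w j := fun j => G.nonneg i j
  set W := ∑ j, w j with hW
  have hW0 : 0 ≤ W := Finset.sum_nonneg fun j _ => hw j
  have hWeq : (∑ j, if IsCritical ⟪v i, v j⟫ then G.weight i j else 0) = W :=
    (sum_subtype_eq_sum_ite (fun j => IsCritical ⟪v i, v j⟫) (fun j => G.weight i j)).symm
  have hind : IndepFun (fun x => ⟪x, v i⟫) (fun x j => ⟪x, b j⟫) γ :=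
    indepFun_inner_stdGaussian fun j => inner_sub_inner_smul hv i j
  set D : ({j // IsCritical ⟪v i, v j⟫} → ℝ) → ℝ := fun y => ∑ j, w j * sgn (y j) with hD
  set B : ({j // IsCritical ⟪v i, v j⟫} → ℝ) → ℝ :=
    fun y => ∑ j, w j * if |y j| < 2 * ε then 1 else 0 with hB
  set H : EuclideanSpace ℝ (Fin d) → ℝ := fun x => ∑ j, (if IsCritical ⟪v i, v j⟫ then 0 else
    G.weight i j * if ¬ (0 ≤ ⟪x, v i⟫ ↔ 0 ≤ ⟪x, v j⟫) then 1 else 0) with hH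
  have hDm : Measurable D := by
    have := measurable_sgn
    fun_prop
  have hite : Measurable fun t : ℝ => if |t| < 2 * ε then (1 : ℝ) else 0 :=
    Measurable.ite (measurableSet_lt (by fun_prop) measurable_const) measurable_const
      measurable_const
  have hBm : Measurable B := Finset.measurable_sum _ fun j _ =>
    (hite.comp (measurable_pi_apply j)).const_mul _
  have hDb : ∀ y, |D y| ≤ W := fun y => abs_sum_sgn_le y hw
  have hB0 : ∀ y, 0 ≤ B y := fun y => Finset.sum_nonneg fun j _ =>
    mul_nonneg (hw j) (by split_ifs <;> norm_num)
  have hBb : ∀ y, B y ≤ W := fun y => Finset.sum_le_sum fun j _ =>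
    mul_le_of_le_one_right (hw j) (by split_ifs <;> norm_num)
  have hH0 : ∀ x, 0 ≤ H x := fun x => Finset.sum_nonneg fun j _ => by
    split_ifs <;> simp [G.nonneg i j]
  set φ₁ : ℝ → ℝ := fun t => if 0 ≤ t ∧ t < ε then 1 else 0 with hφ₁
  set φ₂ : ℝ → ℝ := fun t => if -ε < t ∧ t < 0 then 1 else 0 with hφ₂
  set φ₃ : ℝ → ℝ := fun t => if |t| < ε then 1 else 0 with hφ₃
  have hm₁ : Measurable φ₁ := Measurable.ite measurableSet_Ico measurable_const measurable_const
  have hm₂ : Measurable φ₂ := Measurable.ite measurableSet_Ioo measurable_const measurable_const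
  have hm₃ : Measurable φ₃ :=
    Measurable.ite (measurableSet_lt (by fun_prop) measurable_const) measurable_const
      measurable_const
  have hprod : ∀ (φ : ℝ → ℝ) (Ψ : ({j // IsCritical ⟪v i, v j⟫} → ℝ) → ℝ), Measurable φ →
      Measurable Ψ → ∫ x, φ ⟪x, v i⟫ * Ψ (fun j => ⟪x, b j⟫) ∂γ
        = (∫ x, φ ⟪x, v i⟫ ∂γ) * ∫ x, Ψ (fun j => ⟪x, b j⟫) ∂γ := fun φ Ψ hφ hΨ =>
    (hind.comp hφ hΨ).integral_fun_mul_eq_mul_integral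
      (hφ.comp (by fun_prop)).aestronglyMeasurable (hΨ.comp (by fun_prop)).aestronglyMeasurable
  -- The surplus is roughly the positive part of `sgn t * D`, hence of `D` for `t ≥ 0` and of `-D`
  -- for `t < 0`. By independence each factors, and the two positive parts add up to `|D|`. The loss
  -- `H` is subtracted everywhere, not only for `|t| < ε`, which keeps its integral simple.
  have hpoint : ∀ x, φ₁ ⟪x, v i⟫ * max (D fun j => ⟪x, b j⟫) 0
      + φ₂ ⟪x, v i⟫ * max (-D fun j => ⟪x, b j⟫) 0
      - 2 * (φ₃ ⟪x, v i⟫ * B fun j => ⟪x, b j⟫) - H x ≤ surplus G v ε x i := by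
    intro x
    have hHx := hH0 x
    have hBx := hB0 fun j => ⟪x, b j⟫
    by_cases ht : |⟪x, v i⟫| < ε
    · have key := stable_sub_cross_ge G hv.unit x i ht
      have h3 : φ₃ ⟪x, v i⟫ = 1 := if_pos ht
      rw [h3, one_mul, surplus, if_pos ht]
      have key' : sgn ⟪x, v i⟫ * (D fun j => ⟪x, b j⟫) - 2 * (B fun j => ⟪x, b j⟫) - H x
        ≤ stableWeight G v ε x i - crossWeight G v x i := key
      rw [abs_lt] at ht
      rcases le_or_gt 0 ⟪x, v i⟫ with h | h
      · have h1 : φ₁ ⟪x, v i⟫ = 1 := if_pos ⟨h, ht.2⟩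
        have h2 : φ₂ ⟪x, v i⟫ = 0 := if_neg fun h' => absurd h'.2 (not_lt.2 h)
        rw [h1, h2, one_mul, zero_mul, add_zero]
        rw [sgn, if_pos h, one_mul] at key'
        rcases le_total (D fun j => ⟪x, b j⟫) 0 with h0 | h0
        · rw [max_eq_right h0]
          exact le_trans (by linarith) (le_max_right _ _)
        · rw [max_eq_left h0]
          exact key'.trans (le_max_left _ _)
      · have h1 : φ₁ ⟪x, v i⟫ = 0 := if_neg fun h' => absurd h'.1 (not_le.2 h)
        have h2 : φ₂ ⟪x, v i⟫ = 1 := if_pos ⟨ht.1, h⟩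
        rw [h1, h2, one_mul, zero_mul, zero_add]
        rw [sgn, if_neg (not_le.2 h), neg_one_mul] at key'
        rcases le_total (-D fun j => ⟪x, b j⟫) 0 with h0 | h0
        · rw [max_eq_right h0]
          exact le_trans (by linarith) (le_max_right _ _)
        · rw [max_eq_left h0]
          exact key'.trans (le_max_left _ _)
    · have h1 : φ₁ ⟪x, v i⟫ = 0 := if_neg fun h' => ht (by rw [abs_of_nonneg h'.1]; exact h'.2)
      have h2 : φ₂ ⟪x, v i⟫ = 0 :=
        if_neg fun h' => ht (by rw [abs_of_neg h'.2]; linarith [h'.1])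
      have h3 : φ₃ ⟪x, v i⟫ = 0 := if_neg ht
      rw [h1, h2, h3, surplus, if_neg ht]
      linarith
  have habs₁ : ∀ t, |φ₁ t| ≤ 1 := fun t => by simp only [hφ₁]; split_ifs <;> simp
  have habs₂ : ∀ t, |φ₂ t| ≤ 1 := fun t => by simp only [hφ₂]; split_ifs <;> simp
  have habs₃ : ∀ t, |φ₃ t| ≤ 1 := fun t => by simp only [hφ₃]; split_ifs <;> simp
  have hmul : ∀ {a c : ℝ}, |a| ≤ 1 → |c| ≤ W → |a * c| ≤ W := fun {a c} ha hc => by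
    rw [abs_mul]
    nlinarith [abs_nonneg a, abs_nonneg c]
  have hmax : ∀ {a : ℝ}, |a| ≤ W → |max a 0| ≤ W := fun {a} ha => by
    rw [abs_of_nonneg (le_max_right _ _)]
    exact max_le ((le_abs_self a).trans ha) hW0
  have hi₁ : Integrable (fun x => φ₁ ⟪x, v i⟫ * max (D fun j => ⟪x, b j⟫) 0) γ :=
    integrable_of_measurable_of_bound (by fun_prop) W fun x => hmul (habs₁ _) (hmax (hDb _))
  have hi₂ : Integrable (fun x => φ₂ ⟪x, v i⟫ * max (-D fun j => ⟪x, b j⟫) 0) γ :=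
    integrable_of_measurable_of_bound (by fun_prop) W fun x => hmul (habs₂ _)
      (hmax (by rw [abs_neg]; exact hDb _))
  have hi₃ : Integrable (fun x => φ₃ ⟪x, v i⟫ * B fun j => ⟪x, b j⟫) γ :=
    integrable_of_measurable_of_bound (by fun_prop) W fun x => hmul (habs₃ _)
      (by rw [abs_of_nonneg (hB0 _)]; exact hBb _)
  have hsep : ∀ j, Integrable (fun x =>
      if ¬ (0 ≤ ⟪x, v i⟫ ↔ 0 ≤ ⟪x, v j⟫) then (1 : ℝ) else 0) γ := fun j =>
    integrable_of_measurable_of_bound (Measurable.ite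
      (measurableSet_sign_ne (by fun_prop) (by fun_prop)) measurable_const measurable_const) 1
      fun x => by split_ifs <;> simp
  have hiHj : ∀ j, Integrable (fun x => if IsCritical ⟪v i, v j⟫ then 0 else
    G.weight i j * if ¬ (0 ≤ ⟪x, v i⟫ ↔ 0 ≤ ⟪x, v j⟫) then 1 else 0) γ := fun j => by
    by_cases hj : IsCritical ⟪v i, v j⟫
    · simp [hj]
    · simp only [hj, if_false]
      exact (hsep j).const_mul _
  have hiH : Integrable H γ := integrable_finsetSum _ fun j _ => hiHj j
  have hIH : ∫ x, H x ∂γ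
      = ∑ j, (if IsCritical ⟪v i, v j⟫ then 0 else G.weight i j * (arccos ⟪v i, v j⟫ / π)) := by
    rw [hH, integral_finsetSum _ fun j _ => hiHj j]
    refine Finset.sum_congr rfl fun j _ => ?_
    by_cases hj : IsCritical ⟪v i, v j⟫
    · simp [hj]
    · simp only [hj, if_false]
      rw [integral_const_mul, integral_indicator_sign_ne (hv.unit i) (hv.unit j)]
  have hIB : ∫ x, B (fun j => ⟪x, b j⟫) ∂γ ≤ 12 * ε * W := by
    have hi : ∀ j, Integrable (fun x => w j * if |⟪x, b j⟫| < 2 * ε then (1 : ℝ) else 0) γ :=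
      fun j => (integrable_of_measurable_of_bound (hite.comp (by fun_prop)) 1
        fun x => by simp only [Function.comp]; split_ifs <;> simp).const_mul _
    simp only [hB]
    rw [integral_finsetSum _ fun j _ => hi j, hW, Finset.mul_sum]
    refine Finset.sum_le_sum fun j _ => ?_
    rw [integral_const_mul, integral_ite_one (measurableSet_lt (by fun_prop) measurable_const),
      mul_comm (12 * ε)]
    refine mul_le_mul_of_nonneg_left ?_ (hw j)
    refine (stdGaussian_inner_lt_le (by norm_num) (IsCritical.norm_ge hv j.2) (by linarith)).trans
      (le_of_eq ?_)
    ring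
  have hIB0 : 0 ≤ ∫ x, B (fun j => ⟪x, b j⟫) ∂γ := integral_nonneg fun x => hB0 _
  have hp₁ : ε / 10 ≤ ∫ x, φ₁ ⟪x, v i⟫ ∂γ := by
    have hs : MeasurableSet {x | 0 ≤ ⟪x, v i⟫ ∧ ⟪x, v i⟫ < ε} :=
      measurableSet_and (measurableSet_le measurable_const (by fun_prop))
        (measurableSet_lt (by fun_prop) measurable_const)
    simp only [hφ₁]
    rw [integral_ite_one hs]
    exact stdGaussian_inner_Ico_ge (hv.unit i) hε.le hε1
  have hp₂ : ε / 10 ≤ ∫ x, φ₂ ⟪x, v i⟫ ∂γ := by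
    have hs : MeasurableSet {x | -ε < ⟪x, v i⟫ ∧ ⟪x, v i⟫ < 0} :=
      measurableSet_and (measurableSet_lt measurable_const (by fun_prop))
        (measurableSet_lt (by fun_prop) measurable_const)
    simp only [hφ₂]
    rw [integral_ite_one hs]
    exact stdGaussian_inner_Ioo_ge (hv.unit i) hε.le hε1
  have hp₃ : ∫ x, φ₃ ⟪x, v i⟫ ∂γ ≤ ε := by
    simp only [hφ₃]
    rw [integral_ite_one (measurableSet_lt (by fun_prop) measurable_const)]
    exact stdGaussian_inner_mem_le (hv.unit i) hε.le
  have hiD : Integrable (fun x => max (D fun j => ⟪x, b j⟫) 0) γ :=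
    integrable_of_measurable_of_bound (by fun_prop) W fun x => hmax (hDb _)
  have hiD' : Integrable (fun x => max (-D fun j => ⟪x, b j⟫) 0) γ :=
    integrable_of_measurable_of_bound (by fun_prop) W fun x => hmax (by rw [abs_neg]; exact hDb _)
  have hID : δ * W ≤ ∫ x, max (D fun j => ⟪x, b j⟫) 0 ∂γ + ∫ x, max (-D fun j => ⟪x, b j⟫) 0 ∂γ := by
    rw [← integral_add hiD hiD']
    have habs : ∀ a : ℝ, max a 0 + max (-a) 0 = |a| := fun a => by
      rcases le_total a 0 with h | h
      · rw [max_eq_right h, max_eq_left (by linarith), abs_of_nonpos h, zero_add]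
      · rw [max_eq_left h, max_eq_right (by linarith), abs_of_nonneg h, add_zero]
    simp_rw [habs]
    refine integral_abs_sum_sgn_ge (fun j => ?_) (fun j k => IsCritical.inner_ge hv j.2 k.2) hw
    exact norm_pos_iff.1 (lt_of_lt_of_le (by norm_num) (IsCritical.norm_ge hv j.2))
  have hD0 : 0 ≤ ∫ x, max (D fun j => ⟪x, b j⟫) 0 ∂γ := integral_nonneg fun x => le_max_right _ _
  have hD0' : 0 ≤ ∫ x, max (-D fun j => ⟪x, b j⟫) 0 ∂γ := integral_nonneg fun x => le_max_right _ _
  have hfin := integral_mono (((hi₁.add hi₂).sub (hi₃.const_mul 2)).sub hiH)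
    (integrable_surplus G v ε i) hpoint
  simp only [Pi.sub_apply, Pi.add_apply] at hfin
  rw [integral_sub, integral_sub, integral_add hi₁ hi₂, integral_const_mul, hIH,
    hprod φ₁ (fun y => max (D y) 0) hm₁ (by fun_prop),
    hprod φ₂ (fun y => max (-D y) 0) hm₂ (by fun_prop), hprod φ₃ B hm₃ hBm] at hfin
  · rw [hWeq]
    refine le_trans ?_ hfin
    -- The main term is `(ε/10) δ W` and the error is `2 * ε * 12 ε W`; the assumption `480 ε ≤ δ`
    -- makes the error at most half of the main term.
    have e1 := mul_le_mul_of_nonneg_right hp₁ hD0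
    have e2 := mul_le_mul_of_nonneg_right hp₂ hD0'
    have e3 := mul_le_mul hp₃ hIB hIB0 hε.le
    have e4 := mul_le_mul_of_nonneg_left hID (by positivity : 0 ≤ ε / 10)
    have e5 := mul_le_mul_of_nonneg_right hεd (mul_nonneg hε.le hW0)
    linarith
  · exact hi₁.add hi₂
  · exact hi₃.const_mul 2
  · exact (hi₁.add hi₂).sub (hi₃.const_mul 2)
  · exact hiH

end Expectation
end MaxCut

namespace MaxCut
open MeasureTheory ProbabilityTheory Real Set

/-! ### The rounding ratio away from its minimum -/

section Ratio

theorem alphaGW_mul_le {ρ : ℝ} (h1 : -1 ≤ ρ) (h2 : ρ ≤ 1) :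
    alphaGW * ((1 - ρ) / 2) ≤ arccos ρ / π := by
  rcases h2.eq_or_lt with rfl | h2
  · simp
  have hb : BddBelow ((fun ρ : ℝ => (arccos ρ / π) / ((1 - ρ) / 2)) '' Ico (-1) 1) := by
    refine ⟨0, ?_⟩
    rintro _ ⟨ρ, hρ, rfl⟩
    have := hρ.2
    exact div_nonneg (div_nonneg (arccos_nonneg _) pi_pos.le) (by linarith)
  have : alphaGW ≤ (arccos ρ / π) / ((1 - ρ) / 2) := csInf_le hb ⟨ρ, ⟨h1, h2⟩, rfl⟩
  rwa [le_div_iff₀ (by linarith)] at this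

/-- The angle `3π/4` is close enough to the minimiser and has explicit sine and cosine. -/
theorem alphaGW_le : alphaGW ≤ 88 / 100 := by
  have hs : (1.414 : ℝ) ≤ √2 := le_sqrt_of_sq_le (by norm_num)
  have hs2 : √2 ≤ 2 := sqrt_le_left (by norm_num) |>.2 (by norm_num)
  have h := alphaGW_mul_le (ρ := -(√2 / 2)) (by linarith) (by linarith)
  have he : arccos (-(√2 / 2)) / π = 3 / 4 := by
    rw [← cos_pi_div_four, arccos_neg, arccos_cos (by positivity) (by linarith [pi_pos])]
    have := pi_ne_zero
    field_simp
    norm_num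
  rw [he] at h
  by_contra hc
  push Not at hc
  nlinarith

/-- For `ρ ≤ -49/50` the angle is at least `9π/10`, because `cos (π/10) ≤ 1 - 2/100`. On `[-1/3, 0]`
the tangent bound `arcsin ρ ≤ ρ` suffices. For `ρ > 0` concavity of cosine gives a ratio of at least
`1`. -/
theorem ratio_ge_of_not_isCritical {ρ : ℝ} (h1 : -1 ≤ ρ) (h2 : ρ ≤ 1) (h : ¬ IsCritical ρ) :
    9 / 10 * ((1 - ρ) / 2) ≤ arccos ρ / π := by
  have hπ := pi_pos
  rcases le_or_gt ρ (-(49 / 50)) with h3 | h3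
  · have hcos : cos (π / 10) ≤ 49 / 50 := by
      refine (cos_le_one_sub_mul_cos_sq (by rw [abs_of_pos (by positivity)]; linarith)).trans
        (le_of_eq ?_)
      field_simp
      norm_num
    have : π - π / 10 ≤ arccos ρ := by
      rw [← arccos_cos (x := π - π / 10) (by linarith) (by linarith), cos_pi_sub]
      exact arccos_le_arccos (by linarith)
    rw [le_div_iff₀ hπ]
    nlinarith
  have h4 : -(1 / 3) ≤ ρ := by
    by_contra hc
    exact h ⟨h3, not_le.1 hc⟩
  rcases le_or_gt ρ 0 with h5 | h5
  · have : arcsin ρ ≤ ρ := by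
      have hx : ρ ≤ sin ρ := by
        have := sin_le (x := -ρ) (by linarith)
        rw [sin_neg] at this
        linarith
      calc arcsin ρ ≤ arcsin (sin ρ) := monotone_arcsin hx
        _ = ρ := arcsin_sin (by linarith [pi_gt_three]) (by linarith)
    rw [arccos_eq_pi_div_two_sub_arcsin, le_div_iff₀ hπ]
    have h6 := pi_lt_d2
    nlinarith
  · have hx0 := arccos_nonneg ρ
    have hx1 := arccos_le_pi_div_two.2 h5.le
    have := one_sub_mul_le_cos hx0 hx1
    rw [cos_arccos h1 h2] at this
    rw [le_div_iff₀ hπ]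
    have h7 : 2 / π * arccos ρ * π = 2 * arccos ρ := by field_simp
    nlinarith

end Ratio

/-! ### Expected weight of the improved cut -/

section Total

variable {n d : ℕ} {v : Fin n → EuclideanSpace ℝ (Fin d)}

theorem measurable_cutWeight_comp {α : Type*} [MeasurableSpace α] (G : WeightedGraph n)
    {X : α → Fin n → ℤˣ} (hX : ∀ i, MeasurableSet {a | X a i = 1}) :
    Measurable fun a => cutWeight G (X a) := by
  unfold cutWeight
  have h : ∀ u w : ℤˣ, u ≠ w ↔ ¬ (u = 1 ↔ w = 1) := by decide
  simp only [h]
  refine Finset.measurable_sum _ fun i _ => Finset.measurable_sum _ fun j _ =>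
    Measurable.ite ?_ measurable_const measurable_const
  exact ((hX i).iff (hX j)).compl

theorem label_eq_one_iff (v : Fin n → EuclideanSpace ℝ (Fin d)) (x : EuclideanSpace ℝ (Fin d))
    (i : Fin n) : label v x i = 1 ↔ 0 ≤ ⟪x, v i⟫ := by
  unfold label
  split_ifs with h <;> simp [h]

theorem measurableSet_label (v : Fin n → EuclideanSpace ℝ (Fin d)) (i : Fin n) :
    MeasurableSet {x | label v x i = 1} := by
  simp only [label_eq_one_iff]
  exact measurableSet_le measurable_const (by fun_prop)

theorem measurableSet_flipLabel (G : WeightedGraph n) (v : Fin n → EuclideanSpace ℝ (Fin d))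
    (ε : ℝ) (i : Fin n) : MeasurableSet {x | flipLabel G v ε x i = 1} := by
  have h : ∀ x, flipLabel G v ε x i = 1 ↔
      ((|⟪x, v i⟫| < ε ∧ crossWeight G v x i < stableWeight G v ε x i) ↔
        ¬ label v x i = 1) := fun x => by
    have hu : ∀ u : ℤˣ, -u = 1 ↔ ¬ u = 1 := by decide
    unfold flipLabel
    split_ifs with hc
    · rw [hu]; simp only [hc, true_iff, and_self]
    · simp only [hc, false_iff, not_not]
  simp only [h]
  exact (measurableSet_and (measurableSet_lt (by fun_prop) measurable_const)
    (measurableSet_lt (by fun_prop) (by fun_prop))).iff (measurableSet_label v i).compl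

theorem abs_cutWeight_le (G : WeightedGraph n) (x : Fin n → ℤˣ) :
    |cutWeight G x| ≤ ∑ i, ∑ j ∈ Finset.Ioi i, G.weight i j := by
  rw [abs_of_nonneg]
  · exact Finset.sum_le_sum fun i _ => Finset.sum_le_sum fun j _ => by
      split_ifs; exacts [le_rfl, G.nonneg i j]
  · exact Finset.sum_nonneg fun i _ => Finset.sum_nonneg fun j _ => by
      split_ifs; exacts [G.nonneg i j, le_rfl]

/-- The expected weight of the cut produced by hyperplane rounding. -/
theorem integral_cutWeight_label (G : WeightedGraph n) (hv : ∀ i, ‖v i‖ = 1) :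
    ∫ x, cutWeight G (label v x) ∂stdGaussian (EuclideanSpace ℝ (Fin d))
      = 1 / 2 * ∑ i, ∑ j, G.weight i j * (arccos ⟪v i, v j⟫ / π) := by
  simp_rw [cutWeight_eq_half]
  have hi : ∀ i j, Integrable (fun x => G.weight i j *
      if ¬ (0 ≤ ⟪x, v i⟫ ↔ 0 ≤ ⟪x, v j⟫) then (1 : ℝ) else 0)
      (stdGaussian (EuclideanSpace ℝ (Fin d))) := fun i j =>
    (integrable_of_measurable_of_bound (Measurable.ite
      (measurableSet_sign_ne (by fun_prop) (by fun_prop)) measurable_const measurable_const) 1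
      fun x => by split_ifs <;> simp).const_mul _
  have he : ∀ x i j, (if label v x i ≠ label v x j then G.weight i j else 0)
      = G.weight i j * if ¬ (0 ≤ ⟪x, v i⟫ ↔ 0 ≤ ⟪x, v j⟫) then (1 : ℝ) else 0 := fun x i j => by
    simp only [ne_eq, label_eq_iff, mul_ite, mul_one, mul_zero]
  simp_rw [he]
  rw [integral_const_mul, integral_finsetSum _ fun i _ => integrable_finsetSum _ fun j _ => hi i j]
  congr 1
  refine Finset.sum_congr rfl fun i _ => ?_
  rw [integral_finsetSum _ fun j _ => hi i j]
  refine Finset.sum_congr rfl fun j _ => ?_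
  rw [integral_const_mul, integral_indicator_sign_ne (hv i) (hv j)]

theorem integral_cutWeight_flipLabel_ge (G : WeightedGraph n) (hv : IsFeasible v) {ε κ : ℝ}
    (hε : 0 < ε) (hεd : 480 * ε ≤ (1 / 2 : ℝ) ^ (4 * d + 10))
    (hκ : 1000 * κ ≤ ε * (1 / 2 : ℝ) ^ (4 * d + 10)) :
    (alphaGW + κ) * sdpValue G v
      ≤ ∫ x, cutWeight G (flipLabel G v ε x) ∂stdGaussian (EuclideanSpace ℝ (Fin d)) := by
  classical
  set δ : ℝ := (1 / 2 : ℝ) ^ (4 * d + 10) with hδ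
  have hδ0 : 0 < δ := by positivity
  have hδ1 : δ ≤ 1 := pow_le_one₀ (by norm_num) (by norm_num)
  have hflip : Integrable (fun x => cutWeight G (flipLabel G v ε x))
      (stdGaussian (EuclideanSpace ℝ (Fin d))) :=
    integrable_of_measurable_of_bound
      (measurable_cutWeight_comp G fun i => measurableSet_flipLabel G v ε i) _
      fun x => abs_cutWeight_le G _
  have hlab : Integrable (fun x => cutWeight G (label v x))
      (stdGaussian (EuclideanSpace ℝ (Fin d))) :=
    integrable_of_measurable_of_bound
      (measurable_cutWeight_comp G fun i => measurableSet_label v i) _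
      fun x => abs_cutWeight_le G _
  have hsur : Integrable (fun x => ∑ i, surplus G v ε x i)
      (stdGaussian (EuclideanSpace ℝ (Fin d))) :=
    integrable_finsetSum _ fun i _ => integrable_surplus G v ε i
  have h1 := integral_mono (hlab.add hsur) hflip fun x => cutWeight_flipLabel_ge G v ε x
  simp only [Pi.add_apply] at h1
  rw [integral_add hlab hsur, integral_cutWeight_label G hv.unit,
    integral_finsetSum _ fun i _ => integrable_surplus G v ε i] at h1
  refine le_trans ?_ h1
  -- Surpluses are nonnegative, so a fraction `1/100` of their lower bound may be used. Then the
  -- charge to a noncritical edge fits into its slack, `0.49 * 0.9 ≥ 0.881 / 2`, and a critical edge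
  -- still gains `εδ/2000 ≥ κ/2`.
  have h2 : ∑ i, 1 / 100 * (ε * δ / 20 *
        (∑ j, if IsCritical ⟪v i, v j⟫ then G.weight i j else 0)
      - ∑ j, (if IsCritical ⟪v i, v j⟫ then 0 else G.weight i j * (arccos ⟪v i, v j⟫ / π)))
      ≤ ∑ i, ∫ x, surplus G v ε x i ∂stdGaussian (EuclideanSpace ℝ (Fin d)) := by
    refine Finset.sum_le_sum fun i _ => ?_
    have h3 := integral_surplus_ge G hv hε hεd i
    have h4 : 0 ≤ ∫ x, surplus G v ε x i ∂stdGaussian (EuclideanSpace ℝ (Fin d)) :=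
      integral_nonneg fun x => surplus_nonneg G v ε x i
    linarith
  refine le_trans ?_ (add_le_add_right h2 _)
  rw [sdpValue_eq_quarter, Finset.mul_sum, Finset.mul_sum, Finset.mul_sum,
    ← Finset.sum_add_distrib]
  refine Finset.sum_le_sum fun i _ => ?_
  rw [Finset.mul_sum, Finset.mul_sum, Finset.mul_sum, Finset.mul_sum, ← Finset.sum_sub_distrib,
    Finset.mul_sum, ← Finset.sum_add_distrib]
  refine Finset.sum_le_sum fun j _ => ?_
  have hρ : |⟪v i, v j⟫| ≤ 1 := by simpa [hv.unit] using abs_real_inner_le_norm (v i) (v j)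
  rw [abs_le] at hρ
  have hα := alphaGW_mul_le hρ.1 hρ.2
  have hα2 := alphaGW_le
  have hw := G.nonneg i j
  set s := (1 - ⟪v i, v j⟫) / 2 with hs
  have hs0 : 0 ≤ s := by linarith [hρ.2]
  have hs1 : s ≤ 1 := by linarith [hρ.1]
  by_cases hc : IsCritical ⟪v i, v j⟫
  · simp only [hc, if_true]
    generalize arccos ⟪v i, v j⟫ / π = A at *
    have : (alphaGW + κ) * (1 / 2 * s) ≤ 1 / 2 * A + 1 / 100 * (ε * δ / 20) := by
      have : 1000 * κ * s ≤ ε * δ := by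
        have h5 := mul_le_mul_of_nonneg_right hκ hs0
        have h6 : ε * δ * s ≤ ε * δ := mul_le_of_le_one_right (by positivity) hs1
        linarith
      linarith
    have := mul_le_mul_of_nonneg_left this hw
    linarith
  · simp only [hc, if_false]
    have hr := ratio_ge_of_not_isCritical hρ.1 hρ.2 hc
    generalize arccos ⟪v i, v j⟫ / π = A at *
    have : (alphaGW + κ) * (1 / 2 * s) ≤ 1 / 2 * A - 1 / 100 * A := by
      have hκ2 : κ ≤ 1 / 1000 := by
        have : ε * δ ≤ 1 := mul_le_one₀ (by linarith) hδ0.le hδ1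
        linarith
      have : (alphaGW + κ) * s ≤ (881 / 1000) * s :=
        mul_le_mul_of_nonneg_right (by linarith) hs0
      linarith
    have := mul_le_mul_of_nonneg_left this hw
    linarith

end Total

/-! ### From the sample stream to the Gaussian vector -/

section Stream

variable {n d : ℕ}

/-- The vector of the first `d` samples. -/
noncomputable def sampleVec (d : ℕ) (ω : ℕ → ℝ) : EuclideanSpace ℝ (Fin d) :=
  WithLp.toLp 2 fun k => ω k

@[fun_prop]
theorem measurable_sampleVec (d : ℕ) : Measurable (sampleVec d) := by
  unfold sampleVec
  fun_prop

theorem map_sampleVec (d : ℕ) :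
    gaussianStream.map (sampleVec d) = stdGaussian (EuclideanSpace ℝ (Fin d)) := by
  have h : gaussianStream.map (fun ω (k : Fin d) => ω k)
      = Measure.pi fun _ : Fin d => gaussianReal 0 1 := by
    rw [gaussianStream, ← Measure.infinitePi_eq_pi]
    exact Measure.map_infinitePi_infinitePi_of_inj (f := fun k : Fin d => (k : ℕ))
      Fin.val_injective
  rw [← map_pi_eq_stdGaussian, ← h, Measure.map_map (by fun_prop) (by fun_prop)]
  rfl

theorem gwLabel_eq_label (v : Fin n → EuclideanSpace ℝ (Fin d)) (ω : ℕ → ℝ) (i : Fin n) :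
    gwLabel v ω i = label v (sampleVec d ω) i := rfl

theorem isLocalFlip_flipLabel (G : WeightedGraph n) (v : Fin n → EuclideanSpace ℝ (Fin d)) (ε : ℝ)
    (ω : ℕ → ℝ) : IsLocalFlip G v ε ω (flipLabel G v ε (sampleVec d ω)) := by
  intro i hi
  rw [gwLabel_eq_label, flipLabel] at hi
  split_ifs at hi with h
  · refine ⟨h.1, ?_⟩
    convert h.2 using 1 <;> exact Finset.sum_congr rfl fun j _ => by congr
  · exact absurd rfl hi

theorem integrable_cutWeight_stream (G : WeightedGraph n) (v : Fin n → EuclideanSpace ℝ (Fin d))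
    (ε : ℝ) : Integrable (fun ω => cutWeight G (flipLabel G v ε (sampleVec d ω)))
      gaussianStream := by
  have : IsProbabilityMeasure gaussianStream := by unfold gaussianStream; infer_instance
  refine Integrable.of_bound (Measurable.aestronglyMeasurable ?_) _
    (ae_of_all _ fun ω => abs_cutWeight_le G _)
  exact (measurable_cutWeight_comp G fun i => measurableSet_flipLabel G v ε i).comp
    (measurable_sampleVec d)

theorem integral_cutWeight_stream (G : WeightedGraph n) (v : Fin n → EuclideanSpace ℝ (Fin d))
    (ε : ℝ) : ∫ ω, cutWeight G (flipLabel G v ε (sampleVec d ω)) ∂gaussianStream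
      = ∫ x, cutWeight G (flipLabel G v ε x) ∂stdGaussian (EuclideanSpace ℝ (Fin d)) := by
  rw [← map_sampleVec, integral_map (by fun_prop)]
  exact (measurable_cutWeight_comp G
    fun i => measurableSet_flipLabel G v ε i).aestronglyMeasurable

theorem IsFeasible.dim_pos {v : Fin n → EuclideanSpace ℝ (Fin d)} (hv : IsFeasible v)
    (hn : 0 < n) : 0 < d := by
  rcases Nat.eq_zero_or_pos d with rfl | h
  · have := hv.unit ⟨0, hn⟩
    rw [Subsingleton.elim (v ⟨0, hn⟩) 0, norm_zero] at this
    exact absurd this zero_ne_one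
  · exact h

theorem gw_bound_stream (G : WeightedGraph n) {v : Fin n → EuclideanSpace ℝ (Fin d)}
    (hv : IsFeasible v) :
    (alphaGW + (1 / 2 : ℝ) ^ (47 * d)) * sdpValue G v
      ≤ ∫ ω, cutWeight G (flipLabel G v ((1 / 2 : ℝ) ^ (23 * d)) (sampleVec d ω))
        ∂gaussianStream := by
  -- Without vertices the dimension may be `0`; otherwise unit vectors force `d ≥ 1`, which lets
  -- multiples of `d` absorb the additive constants below.
  rcases Nat.eq_zero_or_pos n with rfl | hn
  · simp [sdpValue, cutWeight]
  have hd := hv.dim_pos hn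
  rw [integral_cutWeight_stream]
  have hmono : ∀ {a b : ℕ}, a ≤ b → (1 / 2 : ℝ) ^ b ≤ (1 / 2 : ℝ) ^ a := fun h =>
    pow_le_pow_of_le_one (by norm_num) (by norm_num) h
  refine integral_cutWeight_flipLabel_ge G hv (by positivity) ?_ ?_
  · have h1 : (1 / 2 : ℝ) ^ (23 * d) ≤ (1 / 2 : ℝ) ^ (4 * d + 10 + 9) := hmono (by lia)
    rw [pow_add] at h1
    have : (0 : ℝ) < (1 / 2) ^ (4 * d + 10) := by positivity
    norm_num at h1 ⊢
    linarith
  · have h1 : (1 / 2 : ℝ) ^ (47 * d) ≤ (1 / 2 : ℝ) ^ (23 * d + (4 * d + 10) + 10) :=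
      hmono (by lia)
    rw [pow_add, pow_add] at h1
    have : (0 : ℝ) < (1 / 2) ^ (23 * d) * (1 / 2) ^ (4 * d + 10) := by positivity
    have h2 : ((1 : ℝ) / 2) ^ 10 = 1 / 1024 := by norm_num
    rw [h2] at h1
    linarith

end Stream
end MaxCut

namespace MaxCut

/-! ### Program logic with cost bounds -/

section Hoare

/-- `P` started in `s` halts at cost at most `T` in a state satisfying `Q`. -/
def Halts (ω : ℕ → ℝ) (P : Program) (s : State) (T : ℕ) (Q : State → Prop) : Prop :=
  ∃ t s', Exec ω P s t s' ∧ t ≤ T ∧ Q s'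

variable {ω : ℕ → ℝ}

theorem Halts.seq {P P' : Program} {s : State} {T T' : ℕ} {Q R : State → Prop}
    (h : Halts ω P s T R) (h' : ∀ s', R s' → Halts ω P' s' T' Q) :
    Halts ω (.seq P P') s (T + T') Q := by
  obtain ⟨t, s₁, he, ht, hR⟩ := h
  obtain ⟨t', s₂, he', ht', hQ⟩ := h' s₁ hR
  exact ⟨t + t', s₂, he.seq he', by lia, hQ⟩

theorem Halts.mono {P : Program} {s : State} {T T' : ℕ} {Q R : State → Prop}
    (h : Halts ω P s T R) (hT : T ≤ T') (hQ : ∀ s', R s' → Q s') : Halts ω P s T' Q := by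
  obtain ⟨t, s', he, ht, hR⟩ := h
  exact ⟨t, s', he, ht.trans hT, hQ s' hR⟩

/-- Programs without loops. -/
def Program.LoopFree : Program → Prop
  | .seq P Q => P.LoopFree ∧ Q.LoopFree
  | .ite _ P Q => P.LoopFree ∧ Q.LoopFree
  | .loop _ _ => False
  | _ => True

/-- The largest cost of an execution of a program without loops. -/
def Program.maxCost : Program → ℕ
  | .skip => 1
  | .setReg _ e => e.cost + 1
  | .setMem _ e f r => e.cost + f.cost + r.cost + 1
  | .sample _ e f => e.cost + f.cost + 1
  | .seq P Q => P.maxCost + Q.maxCost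
  | .ite b P Q => b.cost + max P.maxCost Q.maxCost
  | .loop _ _ => 0

open Classical in
/-- The final state of a program without loops. -/
noncomputable def Program.run (ω : ℕ → ℝ) : Program → State → State
  | .skip, s => s
  | .setReg x e, s => s.putReg x (e.eval s)
  | .setMem a e f r, s => s.putMem a (e.eval s) (f.eval s) (r.eval s)
  | .sample a e f, s =>
      { s.putMem a (e.eval s) (f.eval s) (ω s.used) with used := s.used + 1 }
  | .seq P Q, s => Q.run ω (P.run ω s)
  | .ite b P Q, s => if b.Holds s then P.run ω s else Q.run ω s
  | .loop _ _, s => s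

theorem Program.LoopFree.exec {P : Program} (h : P.LoopFree) (s : State) :
    ∃ t ≤ P.maxCost, Exec ω P s t (P.run ω s) := by
  induction P generalizing s with
  | skip => exact ⟨1, le_rfl, .skip s⟩
  | setReg x e => exact ⟨_, le_rfl, .setReg s x e⟩
  | setMem a e f r => exact ⟨_, le_rfl, .setMem s a e f r⟩
  | sample a e f => exact ⟨_, le_rfl, .sample s a e f⟩
  | seq P Q ihP ihQ =>
    obtain ⟨t, ht, he⟩ := ihP h.1 s
    obtain ⟨t', ht', he'⟩ := ihQ h.2 (P.run ω s)
    exact ⟨t + t', Nat.add_le_add ht ht', he.seq he'⟩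
  | ite b P Q ihP ihQ =>
    by_cases hb : b.Holds s
    · obtain ⟨t, ht, he⟩ := ihP h.1 s
      refine ⟨b.cost + t, Nat.add_le_add_left (ht.trans (le_max_left _ _)) _, ?_⟩
      rw [Program.run, if_pos hb]
      exact .iteTrue hb he
    · obtain ⟨t, ht, he⟩ := ihQ h.2 s
      refine ⟨b.cost + t, Nat.add_le_add_left (ht.trans (le_max_right _ _)) _, ?_⟩
      rw [Program.run, if_neg hb]
      exact .iteFalse hb he
  | loop b P _ => exact h.elim

theorem Program.LoopFree.halts {P : Program} (h : P.LoopFree) {s : State} {T : ℕ}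
    {Q : State → Prop} (hT : P.maxCost ≤ T) (hQ : Q (P.run ω s)) : Halts ω P s T Q := by
  obtain ⟨t, ht, he⟩ := h.exec (ω := ω) s
  exact ⟨t, _, he, ht.trans hT, hQ⟩

/-- Let register `x` run from `0` up to the contents of register `y`. -/
def forLoop (x y : ℕ) (P : Program) : Program :=
  .seq (.setReg x (.const 0))
    (.loop (.natLT (.reg x) (.reg y)) (.seq P (.setReg x (.add (.reg x) (.const 1)))))

theorem Halts.loop {b : Test} {P : Program} (I : ℕ → State → Prop) {N B : ℕ}
    (hstep : ∀ k < N, ∀ s, I k s → b.Holds s ∧ Halts ω P s B (I (k + 1)))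
    (hend : ∀ s, I N s → ¬ b.Holds s) {s : State} {k : ℕ} (hk : k ≤ N) (hI : I k s) :
    Halts ω (.loop b P) s ((N - k) * (b.cost + B) + b.cost) (I N) := by
  induction hk using Nat.decreasingInduction generalizing s with
  | self => exact ⟨b.cost, s, .loopDone (hend s hI), by simp, hI⟩
  | of_succ k hk ih =>
    obtain ⟨hb, t, s₁, he, ht, hI₁⟩ := hstep k hk s hI
    obtain ⟨t', s₂, he', ht', hI₂⟩ := ih hI₁
    refine ⟨_, s₂, .loopStep hb he he', ?_, hI₂⟩
    rw [show N - k = (N - (k + 1)) + 1 by lia, add_mul]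
    lia

/-- Each round costs the body plus `3` for the test and `4` for the increment; initialisation and
the final failing test cost `2 + 3`. -/
theorem Halts.forLoop {x y : ℕ} {P : Program} (I : ℕ → State → Prop) {N B : ℕ} {s : State}
    (hreg : ∀ k s, I k s → s.reg x = k ∧ s.reg y = N) (h0 : I 0 (s.putReg x 0))
    (hstep : ∀ k < N, ∀ s, I k s →
      Halts ω P s B fun s' => s'.reg x = k ∧ I (k + 1) (s'.putReg x (k + 1))) :
    Halts ω (forLoop x y P) s (N * (B + 7) + 5) (I N) := by
  refine Halts.mono (Halts.seq (T := 2) (T' := (N - 0) * (3 + (B + 4)) + 3) (R := I 0)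
    (Program.LoopFree.halts (by exact trivial) le_rfl h0) fun s' hs' =>
      Halts.loop I (B := B + 4) ?_ ?_ (Nat.zero_le N) hs') (by lia) fun _ h => h
  · intro k hk s hs
    obtain ⟨hx, hy⟩ := hreg k s hs
    refine ⟨?_, Halts.seq (hstep k hk s hs) fun s' hs' =>
      Program.LoopFree.halts (by exact trivial) le_rfl ?_⟩
    · simp only [Test.Holds, NatExpr.eval, hx, hy, hk]
    · simp only [Program.run, NatExpr.eval, hs'.1, hs'.2]
  · intro s hs
    obtain ⟨hx, hy⟩ := hreg N s hs
    simp only [Test.Holds, NatExpr.eval, hx, hy, lt_irrefl, not_false_eq_true]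

end Hoare

/-! ### The rounding program and its correctness -/

section Rounding

/-- Read `d` samples into array `3` and store `(1 / 2) ^ (c * d)` in array `4`. -/
def samplePhase (c : ℕ) : Program :=
  .seq (.setMem 4 (.const 0) (.const 0) (.const 1))
    (forLoop 2 1
      (.seq (.setMem 4 (.const 0) (.const 0)
          (.mul (.read 4 (.const 0) (.const 0)) (.const ((1 / 2) ^ c))))
        (.sample 3 (.reg 2) (.const 0))))

/-- Add `g j * v i j` to the accumulator in array `8`. -/
def projStep : Program :=
  .setMem 8 (.const 0) (.const 0) (.add (.read 8 (.const 0) (.const 0))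
    (.mul (.read 3 (.reg 3) (.const 0)) (.read 0 (.reg 2) (.reg 3))))

/-- Store the projection and the label of vertex `i` in arrays `5` and `6`. -/
def storeProj : Program :=
  .seq (.setMem 5 (.reg 2) (.const 0) (.read 8 (.const 0) (.const 0)))
    (.ite (.realLT (.read 8 (.const 0) (.const 0)) (.const 0))
      (.setMem 6 (.reg 2) (.const 0) (.const (-1)))
      (.setMem 6 (.reg 2) (.const 0) (.const 1)))

/-- Compute all projections and labels. -/
def projPhase : Program :=
  forLoop 2 0
    (.seq (.seq (.setMem 8 (.const 0) (.const 0) (.const 0)) (forLoop 3 1 projStep)) storeProj)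

/-- Add `w i j` to the accumulator. -/
def addWeight : Program :=
  .setMem 8 (.const 0) (.const 0)
    (.add (.read 8 (.const 0) (.const 0)) (.read 1 (.reg 2) (.reg 3)))

/-- Add the contribution of the neighbour `j` to the surplus of vertex `i`. -/
def surplusStep : Program :=
  .ite (.realLT (.mul (.read 6 (.reg 2) (.const 0)) (.read 6 (.reg 3) (.const 0))) (.const 0))
    (.setMem 8 (.const 0) (.const 0)
      (.sub (.read 8 (.const 0) (.const 0)) (.read 1 (.reg 2) (.reg 3))))
    (.ite (.realLT (.read 5 (.reg 3) (.const 0)) (.read 4 (.const 0) (.const 0)))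
      (.ite (.realLT (.sub (.const 0) (.read 4 (.const 0) (.const 0)))
          (.read 5 (.reg 3) (.const 0)))
        .skip addWeight)
      addWeight)

/-- Write the final label of vertex `i`. -/
def storeLabel : Program :=
  .seq (.setMem 2 (.reg 2) (.const 0) (.read 6 (.reg 2) (.const 0)))
    (.ite (.realLT (.const 0) (.read 8 (.const 0) (.const 0)))
      (.ite (.realLT (.read 5 (.reg 2) (.const 0)) (.read 4 (.const 0) (.const 0)))
        (.ite (.realLT (.sub (.const 0) (.read 4 (.const 0) (.const 0)))
            (.read 5 (.reg 2) (.const 0)))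
          (.setMem 2 (.reg 2) (.const 0) (.sub (.const 0) (.read 6 (.reg 2) (.const 0))))
          .skip)
        .skip)
      .skip)

/-- Compute all surpluses and output the final labels. -/
def flipPhase : Program :=
  forLoop 2 0
    (.seq (.seq (.setMem 8 (.const 0) (.const 0) (.const 0)) (forLoop 3 0 surplusStep)) storeLabel)

/-- Hyperplane rounding followed by local flips, with threshold `(1 / 2) ^ (c * d)`. -/
def roundingProgram (c : ℕ) : Program :=
  .seq (samplePhase c) (.seq projPhase flipPhase)

variable {n d : ℕ} {ω : ℕ → ℝ} {U W : ℕ → ℕ → ℝ}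

/-- The input is stored in registers `0`, `1` and arrays `0`, `1`. -/
structure InputAt (n d : ℕ) (U W : ℕ → ℕ → ℝ) (s : State) : Prop where
  hn : s.reg 0 = n
  hd : s.reg 1 = d
  hU : ∀ i j, s.mem 0 i j = U i j
  hW : ∀ i j, s.mem 1 i j = W i j

/-- Projection of row `i` of `U` to the samples. -/
noncomputable def projAt (d : ℕ) (ω : ℕ → ℝ) (U : ℕ → ℕ → ℝ) (i : ℕ) : ℝ :=
  ∑ k ∈ Finset.range d, ω k * U i k

/-- Sign of the projection. -/
noncomputable def labelAt (d : ℕ) (ω : ℕ → ℝ) (U : ℕ → ℕ → ℝ) (i : ℕ) : ℝ :=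
  if projAt d ω U i < 0 then -1 else 1

/-- Contribution of the neighbour `j` to the surplus of vertex `i`. -/
noncomputable def surplusTerm (d : ℕ) (ω : ℕ → ℝ) (U W : ℕ → ℕ → ℝ) (ε : ℝ) (i j : ℕ) : ℝ :=
  if labelAt d ω U i * labelAt d ω U j < 0 then -W i j
  else if projAt d ω U j < ε ∧ 0 - ε < projAt d ω U j then 0 else W i j

/-- Final label of vertex `i`. -/
noncomputable def outputAt (n d : ℕ) (ω : ℕ → ℝ) (U W : ℕ → ℕ → ℝ) (ε : ℝ) (i : ℕ) : ℝ :=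
  if 0 < ∑ j ∈ Finset.range n, surplusTerm d ω U W ε i j ∧
    projAt d ω U i < ε ∧ 0 - ε < projAt d ω U i then 0 - labelAt d ω U i else labelAt d ω U i

/-- The threshold depends on `d` and so is no constant of the program; it is built up by one
multiplication by `(1/2)^c` per sample. The invariant ties the counter to `used`, so that cell `k`
receives exactly `ω k`. -/
theorem halts_samplePhase (c : ℕ) {s : State} (hs : InputAt n d U W s) (hu : s.used = 0) :
    Halts ω (samplePhase c) s (d * 20 + 10) fun s' =>
      InputAt n d U W s' ∧ s'.mem 4 0 0 = (1 / 2 : ℝ) ^ (c * d) ∧ ∀ k < d, s'.mem 3 k 0 = ω k := by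
  refine Halts.mono (Halts.seq (T := 4) (R := fun s => InputAt n d U W s ∧ s.used = 0 ∧
    s.mem 4 0 0 = 1) (Program.LoopFree.halts (by exact trivial) le_rfl ?_) fun s' hs' =>
    Halts.forLoop (fun k s => InputAt n d U W s ∧ s.reg 2 = k ∧ s.used = k ∧
      s.mem 4 0 0 = (1 / 2 : ℝ) ^ (c * k) ∧ ∀ l < k, s.mem 3 l 0 = ω l) (N := d) (B := 11)
      ?_ ?_ ?_) (by lia) ?_
  · refine ⟨⟨?_, ?_, ?_, ?_⟩, ?_, ?_⟩ <;>
      simp [Program.run, State.putMem, NatExpr.eval, RealExpr.eval, hs.hn, hs.hd, hs.hU, hs.hW, hu]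
  · exact fun k s h => ⟨h.2.1, h.1.hd⟩
  · obtain ⟨h, h1, h2⟩ := hs'
    refine ⟨⟨?_, ?_, ?_, ?_⟩, ?_, ?_, ?_, ?_⟩ <;>
      simp [State.putReg, h.hn, h.hd, h.hU, h.hW, h1, h2]
  · rintro k hk s ⟨h, h1, h2, h3, h4⟩
    refine Program.LoopFree.halts (by exact ⟨trivial, trivial⟩) (le_of_eq rfl) ?_
    refine ⟨?_, ⟨?_, ?_, ?_, ?_⟩, ?_, ?_, ?_, ?_⟩
    any_goals simp [Program.run, State.putMem, State.putReg, NatExpr.eval, RealExpr.eval, h.hn,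
      h.hd, h.hU, h.hW, h1, h2, h3]
    · rw [mul_add, mul_one, pow_add, mul_inv]
    · intro l hl
      split_ifs with h5
      · rw [h5]
      · exact h4 l (by lia)
  · exact fun s h => ⟨h.1, h.2.2.2⟩

theorem halts_projPhase {ε : ℝ} {s : State} (hs : InputAt n d U W s) (hε : s.mem 4 0 0 = ε)
    (hg : ∀ k < d, s.mem 3 k 0 = ω k) :
    Halts ω projPhase s (n * (d * 25 + 40) + 5) fun s' =>
      InputAt n d U W s' ∧ s'.mem 4 0 0 = ε ∧
        ∀ l < n, s'.mem 5 l 0 = projAt d ω U l ∧ s'.mem 6 l 0 = labelAt d ω U l := by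
  refine Halts.mono (Halts.forLoop (fun i s => InputAt n d U W s ∧ s.reg 2 = i ∧
    s.mem 4 0 0 = ε ∧ (∀ k < d, s.mem 3 k 0 = ω k) ∧
    ∀ l < i, s.mem 5 l 0 = projAt d ω U l ∧ s.mem 6 l 0 = labelAt d ω U l) (N := n)
    (B := d * 25 + 33) ?_ ?_ ?_) le_rfl fun s h => ⟨h.1, h.2.2.1, h.2.2.2.2⟩
  · exact fun k s h => ⟨h.2.1, h.1.hn⟩
  · refine ⟨⟨?_, ?_, ?_, ?_⟩, ?_, ?_, ?_, ?_⟩ <;>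
      simp [State.putReg, hs.hn, hs.hd, hs.hU, hs.hW, hε]
    exact hg
  · rintro i hi s ⟨h, h1, h2, h3, h4⟩
    refine Halts.mono (Halts.seq (T := 4 + (d * (14 + 7) + 5)) (T' := 15) (Halts.seq (T := 4)
      (R := fun s => InputAt n d U W s ∧ s.reg 2 = i ∧ s.mem 4 0 0 = ε ∧
        (∀ k < d, s.mem 3 k 0 = ω k) ∧
        (∀ l < i, s.mem 5 l 0 = projAt d ω U l ∧ s.mem 6 l 0 = labelAt d ω U l) ∧
        s.mem 8 0 0 = 0)
      (Program.LoopFree.halts (by exact trivial) le_rfl ?_) fun s' hs' =>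
      Halts.forLoop (fun j s => InputAt n d U W s ∧ s.reg 2 = i ∧ s.mem 4 0 0 = ε ∧
        (∀ k < d, s.mem 3 k 0 = ω k) ∧
        (∀ l < i, s.mem 5 l 0 = projAt d ω U l ∧ s.mem 6 l 0 = labelAt d ω U l) ∧
        s.mem 8 0 0 = ∑ k ∈ Finset.range j, ω k * U i k ∧ s.reg 3 = j) (N := d) (B := 14)
        ?_ ?_ ?_) fun s' hs' => Program.LoopFree.halts
          (by exact ⟨trivial, trivial, trivial⟩) (by decide) ?_)
      (by lia) fun _ h => h
    · refine ⟨⟨?_, ?_, ?_, ?_⟩, ?_, ?_, ?_, ?_, ?_⟩ <;>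
        simp [Program.run, State.putMem, NatExpr.eval, RealExpr.eval, h.hn, h.hd, h.hU, h.hW, h1, h2]
      · exact h3
      · exact h4
    · exact fun k s h => ⟨h.2.2.2.2.2.2, h.1.hd⟩
    · obtain ⟨h, h1, h2, h3, h4, h5⟩ := hs'
      refine ⟨⟨?_, ?_, ?_, ?_⟩, ?_, ?_, ?_, ?_, ?_, ?_⟩ <;>
        simp [State.putReg, h.hn, h.hd, h.hU, h.hW, h1, h2, h5]
      · exact h3
      · exact h4
    · rintro j hj s ⟨h, h1, h2, h3, h4, h5, h6⟩
      refine Program.LoopFree.halts (by exact trivial) (by decide) ?_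
      refine ⟨?_, ⟨?_, ?_, ?_, ?_⟩, ?_, ?_, ?_, ?_, ?_, ?_⟩ <;>
        simp [projStep, Program.run, State.putMem, State.putReg, NatExpr.eval, RealExpr.eval, h.hn,
          h.hd, h.hU, h.hW, h1, h2, h5, h6, Finset.sum_range_succ, h3 j hj]
      · exact h3
      · exact h4
    · obtain ⟨h, h1, h2, h3, h4, h5, -⟩ := hs'
      rw [← projAt] at h5
      by_cases hneg : projAt d ω U i < 0
      · refine ⟨?_, ⟨?_, ?_, ?_, ?_⟩, ?_, ?_, ?_, ?_⟩ <;>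
          simp [storeProj, Program.run, Test.Holds, State.putMem, State.putReg, NatExpr.eval,
            RealExpr.eval, h.hn, h.hd, h.hU, h.hW, h1, h2, h5, hneg]
        · exact h3
        · intro l hl
          by_cases hli : l = i
          · simp [hli, labelAt, hneg]
          · simpa [hli] using h4 l (by lia)
      · refine ⟨?_, ⟨?_, ?_, ?_, ?_⟩, ?_, ?_, ?_, ?_⟩ <;>
          simp [storeProj, Program.run, Test.Holds, State.putMem, State.putReg, NatExpr.eval,
            RealExpr.eval, h.hn, h.hd, h.hU, h.hW, h1, h2, h5, hneg]
        · exact h3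
        · intro l hl
          by_cases hli : l = i
          · simp [hli, labelAt, hneg]
          · simpa [hli] using h4 l (by lia)

/-- Decisions read the hyperplane labels in array `6`, which stays untouched, while output goes to
array `2`; thus all flips are simultaneous. -/
theorem halts_flipPhase {ε : ℝ} {s : State} (hs : InputAt n d U W s) (hε : s.mem 4 0 0 = ε)
    (hp : ∀ l < n, s.mem 5 l 0 = projAt d ω U l ∧ s.mem 6 l 0 = labelAt d ω U l) :
    Halts ω flipPhase s (n * (n * 50 + 60) + 5) fun s' =>
      ∀ l < n, s'.mem 2 l 0 = outputAt n d ω U W ε l := by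
  refine Halts.mono (Halts.forLoop (fun i s => InputAt n d U W s ∧ s.reg 2 = i ∧
    s.mem 4 0 0 = ε ∧ (∀ l < n, s.mem 5 l 0 = projAt d ω U l ∧ s.mem 6 l 0 = labelAt d ω U l) ∧
    ∀ l < i, s.mem 2 l 0 = outputAt n d ω U W ε l) (N := n)
    (B := n * 50 + 53) ?_ ?_ ?_) le_rfl fun s h => h.2.2.2.2
  · exact fun k s h => ⟨h.2.1, h.1.hn⟩
  · refine ⟨⟨?_, ?_, ?_, ?_⟩, ?_, ?_, ?_, ?_⟩ <;>
      simp [State.putReg, hs.hn, hs.hd, hs.hU, hs.hW, hε]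
    exact hp
  · rintro i hi s ⟨h, h1, h2, h3, h4⟩
    refine Halts.mono (Halts.seq (T := 4 + (n * (35 + 7) + 5)) (T' := 35) (Halts.seq (T := 4)
      (R := fun s => InputAt n d U W s ∧ s.reg 2 = i ∧ s.mem 4 0 0 = ε ∧
        (∀ l < n, s.mem 5 l 0 = projAt d ω U l ∧ s.mem 6 l 0 = labelAt d ω U l) ∧
        (∀ l < i, s.mem 2 l 0 = outputAt n d ω U W ε l) ∧ s.mem 8 0 0 = 0)
      (Program.LoopFree.halts (by exact trivial) le_rfl ?_) fun s' hs' =>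
      Halts.forLoop (fun j s => InputAt n d U W s ∧ s.reg 2 = i ∧ s.mem 4 0 0 = ε ∧
        (∀ l < n, s.mem 5 l 0 = projAt d ω U l ∧ s.mem 6 l 0 = labelAt d ω U l) ∧
        (∀ l < i, s.mem 2 l 0 = outputAt n d ω U W ε l) ∧
        s.mem 8 0 0 = ∑ k ∈ Finset.range j, surplusTerm d ω U W ε i k ∧ s.reg 3 = j) (N := n)
        (B := 35) ?_ ?_ ?_) fun s' hs' => Program.LoopFree.halts
          (by exact ⟨trivial, ⟨⟨trivial, trivial⟩, trivial⟩, trivial⟩) (by decide) ?_)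
      (by lia) fun _ h => h
    · refine ⟨⟨?_, ?_, ?_, ?_⟩, ?_, ?_, ?_, ?_, ?_⟩ <;>
        simp [Program.run, State.putMem, NatExpr.eval, RealExpr.eval, h.hn, h.hd, h.hU, h.hW, h1, h2]
      · exact h3
      · exact h4
    · exact fun k s h => ⟨h.2.2.2.2.2.2, h.1.hn⟩
    · obtain ⟨h, h1, h2, h3, h4, h5⟩ := hs'
      refine ⟨⟨?_, ?_, ?_, ?_⟩, ?_, ?_, ?_, ?_, ?_, ?_⟩ <;>
        simp [State.putReg, h.hn, h.hd, h.hU, h.hW, h1, h2, h5]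
      · exact h3
      · exact h4
    · rintro j hj s ⟨h, h1, h2, h3, h4, h5, h6⟩
      refine Program.LoopFree.halts (by exact ⟨trivial, ⟨trivial, trivial⟩, trivial⟩)
        (by decide) ?_
      have hrun : surplusStep.run ω s = s.putMem 8 0 0
            (∑ k ∈ Finset.range (j + 1), surplusTerm d ω U W ε i k) ∨
          (surplusStep.run ω s = s ∧ surplusTerm d ω U W ε i j = 0) := by
        rw [Finset.sum_range_succ, surplusTerm]
        simp only [surplusStep, addWeight, Program.run, Test.Holds, NatExpr.eval, RealExpr.eval, h1,
          h6, h2, h5, h.hW, (h3 i hi).2, (h3 j hj).2, (h3 j hj).1, Rat.cast_zero]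
        by_cases c1 : labelAt d ω U i * labelAt d ω U j < 0
        · left
          simp only [c1, if_true, sub_eq_add_neg]
        · by_cases c2 : projAt d ω U j < ε
          · by_cases c3 : 0 - ε < projAt d ω U j
            · right
              simp only [c1, c2, c3, if_true, if_false, and_self]
            · left
              simp only [c1, c2, c3, if_true, if_false, and_false]
          · left
            simp only [c1, c2, if_false, false_and]
      rcases hrun with hrun | ⟨hrun, h0⟩
      · rw [hrun]
        refine ⟨?_, ⟨?_, ?_, ?_, ?_⟩, ?_, ?_, ?_, ?_, ?_, ?_⟩ <;>
          simp [State.putMem, State.putReg, h.hn, h.hd, h.hU, h.hW, h1, h2, h6]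
        · exact h3
        · exact h4
      · rw [hrun]
        refine ⟨h6, ⟨?_, ?_, ?_, ?_⟩, ?_, ?_, ?_, ?_, ?_, ?_⟩ <;>
          simp [State.putReg, h.hn, h.hd, h.hU, h.hW, h1, h2, h5, Finset.sum_range_succ, h0]
        · exact h3
        · exact h4
    · obtain ⟨h, h1, h2, h3, h4, h5, -⟩ := hs'
      -- A flipped vertex has its cell written twice, an unflipped one once; the resulting memory is
      -- the same.
      have hrun : storeLabel.run ω s' = s'.putMem 2 i 0 (outputAt n d ω U W ε i) ∨
          storeLabel.run ω s' = (s'.putMem 2 i 0 (labelAt d ω U i)).putMem 2 i 0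
            (outputAt n d ω U W ε i) := by
        simp only [storeLabel, Program.run, Test.Holds, NatExpr.eval, RealExpr.eval, h1, State.putMem,
          (by decide : ¬ (8 : ℕ) = 2), (by decide : ¬ (5 : ℕ) = 2), (by decide : ¬ (4 : ℕ) = 2),
          (by decide : ¬ (6 : ℕ) = 2), false_and, if_false, h2, h5, (h3 i hi).1, (h3 i hi).2,
          Rat.cast_zero, outputAt]
        split_ifs <;> (simp_all; try grind)
      have hmem : ∀ a k l, (storeLabel.run ω s').mem a k l
          = (s'.putMem 2 i 0 (outputAt n d ω U W ε i)).mem a k l := by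
        rcases hrun with hrun | hrun
        · intro a k l
          rw [hrun]
        · intro a k l
          rw [hrun]
          simp only [State.putMem]
          split_ifs <;> rfl
      have hreg : (storeLabel.run ω s').reg = s'.reg := by
        rcases hrun with hrun | hrun <;> rw [hrun] <;> rfl
      refine ⟨?_, ⟨?_, ?_, ?_, ?_⟩, ?_, ?_, ?_, ?_⟩ <;>
        simp [State.putReg, hmem, hreg, State.putMem, h.hn, h.hd, h.hU, h.hW, h1, h2]
      · exact h3
      · intro l hl
        by_cases hli : l = i
        · simp [hli]
        · simpa [hli] using h4 l (by lia)

theorem halts_roundingProgram (c : ℕ) {s : State} (hs : InputAt n d U W s) (hu : s.used = 0) :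
    Halts ω (roundingProgram c) s (100 * (n + d + 1) ^ 2) fun s' =>
      ∀ l < n, s'.mem 2 l 0 = outputAt n d ω U W ((1 / 2 : ℝ) ^ (c * d)) l :=
  Halts.mono (Halts.seq (halts_samplePhase c hs hu) fun _ h₁ =>
    Halts.seq (halts_projPhase h₁.1 h₁.2.1 h₁.2.2) fun _ h₂ =>
      halts_flipPhase h₂.1 h₂.2.1 h₂.2.2) (by nlinarith) fun _ h => h

theorem inputAt_inputState (G : WeightedGraph n) (v : Fin n → EuclideanSpace ℝ (Fin d)) :
    InputAt n d ((inputState G v).mem 0) ((inputState G v).mem 1) (inputState G v) :=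
  ⟨rfl, rfl, fun _ _ => rfl, fun _ _ => rfl⟩

theorem inputState_mem_zero (G : WeightedGraph n) (v : Fin n → EuclideanSpace ℝ (Fin d))
    (i : Fin n) (k : Fin d) : (inputState G v).mem 0 i k = v i k := by
  simp [inputState]

theorem inputState_mem_one (G : WeightedGraph n) (v : Fin n → EuclideanSpace ℝ (Fin d))
    (i j : Fin n) : (inputState G v).mem 1 i j = G.weight i j := by
  simp [inputState]

theorem projAt_inputState (G : WeightedGraph n) (v : Fin n → EuclideanSpace ℝ (Fin d))
    (i : Fin n) : projAt d ω ((inputState G v).mem 0) i = ⟪sampleVec d ω, v i⟫ := by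
  rw [projAt, Finset.sum_range, PiLp.inner_apply]
  refine Finset.sum_congr rfl fun k _ => ?_
  rw [inputState_mem_zero, RCLike.inner_apply, conj_trivial, mul_comm]
  rfl

theorem labelAt_inputState (G : WeightedGraph n) (v : Fin n → EuclideanSpace ℝ (Fin d))
    (i : Fin n) :
    labelAt d ω ((inputState G v).mem 0) i = ((label v (sampleVec d ω) i : ℤˣ) : ℤ) := by
  rw [labelAt, projAt_inputState, label]
  by_cases h : 0 ≤ ⟪sampleVec d ω, v i⟫
  · simp [h, not_lt.2 h]
  · simp [h, not_le.1 h]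

theorem sum_surplusTerm_inputState (G : WeightedGraph n) (v : Fin n → EuclideanSpace ℝ (Fin d))
    (ε : ℝ) (i : Fin n) :
    ∑ j ∈ Finset.range n, surplusTerm d ω ((inputState G v).mem 0) ((inputState G v).mem 1) ε i j
      = stableWeight G v ε (sampleVec d ω) i - crossWeight G v (sampleVec d ω) i := by
  rw [Finset.sum_range, stableWeight, crossWeight, ← Finset.sum_sub_distrib]
  refine Finset.sum_congr rfl fun j _ => ?_
  rw [surplusTerm, labelAt_inputState, labelAt_inputState, projAt_inputState, inputState_mem_one]
  have hlt : (⟪sampleVec d ω, v j⟫ < ε ∧ 0 - ε < ⟪sampleVec d ω, v j⟫)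
      ↔ ¬ ε ≤ |⟪sampleVec d ω, v j⟫| := by
    rw [not_le, abs_lt, zero_sub, and_comm]
  simp only [hlt]
  -- The program detects separation by the sign of the product of the two labels.
  have hu : ∀ a b : ℤˣ, ((a : ℤ) : ℝ) * ((b : ℤ) : ℝ) < 0 ↔ b ≠ a := fun a b => by
    have h : ∀ a b : ℤˣ, (a : ℤ) * (b : ℤ) < 0 ↔ b ≠ a := by decide
    rw [← h]
    exact_mod_cast Iff.rfl
  simp only [hu]
  by_cases h1 : label v (sampleVec d ω) j = label v (sampleVec d ω) i <;>
    by_cases h2 : ε ≤ |⟪sampleVec d ω, v j⟫| <;> simp [h1, h2]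

theorem outputAt_inputState (G : WeightedGraph n) (v : Fin n → EuclideanSpace ℝ (Fin d)) (ε : ℝ)
    (i : Fin n) :
    outputAt n d ω ((inputState G v).mem 0) ((inputState G v).mem 1) ε i
      = ((flipLabel G v ε (sampleVec d ω) i : ℤˣ) : ℤ) := by
  rw [outputAt, sum_surplusTerm_inputState, projAt_inputState, labelAt_inputState, flipLabel]
  simp only [sub_pos, abs_lt, zero_sub]
  split_ifs with h1 h2 h2
  · simp
  · exact absurd ⟨⟨h1.2.2, h1.2.1⟩, h1.1⟩ h2
  · exact absurd ⟨h2.2, h2.1.2, h2.1.1⟩ h1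
  · rfl

theorem outputsWithin_roundingProgram (c : ℕ) (G : WeightedGraph n)
    (v : Fin n → EuclideanSpace ℝ (Fin d)) (ω : ℕ → ℝ) :
    OutputsWithin (roundingProgram c) G v ω (100 * (n + d + 1) ^ 2)
      (flipLabel G v ((1 / 2 : ℝ) ^ (c * d)) (sampleVec d ω)) := by
  obtain ⟨t, s, he, ht, hQ⟩ :=
    halts_roundingProgram (ω := ω) c (inputAt_inputState G v) rfl
  exact ⟨t, s, he, ht, fun i => by rw [hQ i i.2, outputAt_inputState]⟩

end Rounding
end MaxCut

open MaxCut in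
/-- Rounding low-dimensional solutions of the Max-Cut SDP with triangle inequalities: one program,
one polynomial and absolute constants `C`, `K` serve all graphs, dimensions and solutions. -/
theorem theorem1 :
    ∃ (P : Program) (p : Polynomial ℕ) (C K : ℕ), 0 < C ∧
      ∀ (n d : ℕ) (G : WeightedGraph n) (v : Fin n → EuclideanSpace ℝ (Fin d)), IsFeasible v →
        ∃ X : (ℕ → ℝ) → Fin n → ℤˣ,
          (∀ ω, OutputsWithin P G v ω (p.eval (n + d)) (X ω)) ∧
          (∀ ω, IsLocalFlip G v ((1 / 2 : ℝ) ^ (C * d)) ω (X ω)) ∧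
          MeasureTheory.Integrable (fun ω => cutWeight G (X ω)) gaussianStream ∧
          (alphaGW + (1 / 2 : ℝ) ^ (K * d)) * sdpValue G v ≤
            ∫ ω, cutWeight G (X ω) ∂gaussianStream := by
  refine ⟨roundingProgram 23, Polynomial.C 100 * (Polynomial.X + 1) ^ 2, 23, 47, by norm_num,
    fun n d G v hv => ⟨fun ω => flipLabel G v ((1 / 2 : ℝ) ^ (23 * d)) (sampleVec d ω),
      fun ω => ?_, fun ω => isLocalFlip_flipLabel G v _ ω, integrable_cutWeight_stream G v _,
      gw_bound_stream G hv⟩⟩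
  have h := outputsWithin_roundingProgram 23 G v ω
  simpa using h
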